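/- Let $(R,\mathfrak m)$ be a Noetherian local ring of dimension $d$ which is generalized Cohen-Macaulay, i.e. the local cohomology modules $H^i_{\mathfrak m}(R)$ have finite length for all $i<d$. Let $f_1,\ldots,f_r$ be a part of a system of parameters of $R$ and $I=(f_1,\ldots,f_r)$. Let $e(R/I)$ be the multiplicity of $R/I$ with respect to $\mathfrak m$ (the coefficient $e_0$ in $\ell(R/(I+\mathfrak m^{n+1}))=\sum_{i=0}^{s}(-1)^i e_i\binom{n+s-i}{s-i}$ for $n\gg0$, where $s=\dim R/I$), let $$I(R)=\sum_{i=0}^{d-1}\binom{d-1}{i}\,\ell\big(H^i_{\mathfrak m}(R)\big)$$ be the Buchsbaum invariant of $R$, and put $N=e(R/I)+I(R)+1$. Then for all $\varepsilon_1,\ldots,\varepsilon_r\in\mathfrak m^N$, the ideal $I_N=(f_1+\varepsilon_1,\ldots,f_r+\varepsilon_r)$ satisfies $$\ell\big(H^i_{\mathfrak m}(R/I)\big)=\ell\big(H^i_{\mathfrak m}(R/I_N)\big)\qquad\text{for every } 0\le i<d-r.$$ -/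

import Mathlib

universe u

open IsLocalRing

noncomputable section

namespace GenCM

/-- The local cohomology module `H^i_m(M)` of a module `M` over a local ring `(R, m)`. -/
abbrev LC (R : Type u) [CommRing R] [IsLocalRing R] (i : ℕ)
    (M : Type u) [AddCommGroup M] [Module R M] : ModuleCat.{u} R :=
  (localCohomology (maximalIdeal R) i).obj (ModuleCat.of R M)

/-- `M` is generalized Cohen-Macaulay: `H^i_m(M)` has finite length for all `i < dim M`. -/
def IsGeneralizedCohenMacaulay (R : Type u) [CommRing R] [IsLocalRing R]
    (M : Type u) [AddCommGroup M] [Module R M] : Prop :=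
  ∀ i : ℕ, (i : WithBot ℕ∞) < Module.supportDim R M → IsFiniteLength R (LC R i M)

/-- The dimension of `M` as a natural number
(used for nonzero finitely generated modules over Noetherian local rings,
where the dimension is finite). -/
def dim (R : Type u) [CommRing R] (M : Type u) [AddCommGroup M] [Module R M] : ℕ :=
  ((Module.supportDim R M).unbotD 0).toNat

/-- The Buchsbaum invariant `I(M) = ∑_{i < d} binom(d-1, i) ℓ(H^i_m(M))`, `d = dim M`
(used for generalized Cohen-Macaulay modules, where all the lengths are finite). -/
def buchsbaumInvariant (R : Type u) [CommRing R] [IsLocalRing R]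
    (M : Type u) [AddCommGroup M] [Module R M] : ℕ :=
  ∑ i ∈ Finset.range (dim R M),
    (dim R M - 1).choose i * (Module.length R (LC R i M)).toNat

/-- The Hilbert function `n ↦ ℓ(M / m^(n+1) M)`. -/
def hilbertFunction (R : Type u) [CommRing R] [IsLocalRing R]
    (M : Type u) [AddCommGroup M] [Module R M] (n : ℕ) : ℕ∞ :=
  Module.length R (M ⧸ ((maximalIdeal R) ^ (n + 1) • (⊤ : Submodule R M)))

/-- `e` is the multiplicity of `M`: the leading coefficient `e_0 = e` in the expression
`ℓ(M / m^(n+1) M) = ∑_{i ≤ d} (-1)^i e_i binom(n+d-i, d-i)` for `n ≫ 0`, where `d = dim M`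
and the `e_i` are integers. -/
def IsMultiplicity (R : Type u) [CommRing R] [IsLocalRing R]
    (M : Type u) [AddCommGroup M] [Module R M] (e : ℕ) : Prop :=
  ∃ (d : ℕ) (c : ℕ → ℤ), Module.supportDim R M = d ∧ c 0 = e ∧
    ∀ᶠ n : ℕ in Filter.atTop, ∃ k : ℕ, hilbertFunction R M n = k ∧
      (k : ℤ) = ∑ i ∈ Finset.range (d + 1),
        (-1) ^ i * c i * ((n + d - i).choose (d - i) : ℤ)

open Classical in
/-- The multiplicity `e(M) = e(m, M)`. The number `e` with `IsMultiplicity R M e` is unique, and it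
exists for every nonzero finitely generated module over a Noetherian local ring. -/
def multiplicity (R : Type u) [CommRing R] [IsLocalRing R]
    (M : Type u) [AddCommGroup M] [Module R M] : ℕ :=
  if h : ∃ e : ℕ, IsMultiplicity R M e then h.choose else 0

/-- `x_1, …, x_n` is a system of parameters of `R`:
`n = dim R` and the ideal `(x_1, …, x_n)` is `m`-primary. -/
def IsSystemOfParameters {R : Type u} [CommRing R] [IsLocalRing R] {n : ℕ}
    (x : Fin n → R) : Prop :=
  ringKrullDim R = n ∧ (Ideal.span (Set.range x)).radical = maximalIdeal R

/-- `f_1, …, f_r` can be completed to a system of parameters of `R`. -/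
def IsPartOfSystemOfParameters {R : Type u} [CommRing R] [IsLocalRing R] {r : ℕ}
    (f : Fin r → R) : Prop :=
  ∃ (s : ℕ) (g : Fin s → R), IsSystemOfParameters (Fin.append f g)

/-- `C_N(I)` for `I = (f_1, …, f_r)`: the set of all ideals `(f_1 + ε_1, …, f_r + ε_r)`
with `ε_1, …, ε_r ∈ m^N`. -/
def perturbations {R : Type u} [CommRing R] [IsLocalRing R] {r : ℕ}
    (f : Fin r → R) (N : ℕ) : Set (Ideal R) :=
  {J | ∃ ε : Fin r → R, (∀ j, ε j ∈ maximalIdeal R ^ N) ∧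
    J = Ideal.span (Set.range fun j => f j + ε j)}

end GenCM

end

/-!
Write `M = R/J` with `J` generated by all but one of the elements `f_1, …, f_r`, let `f` be the
remaining one and `f' = f + ε` with `ε ∈ m ^ N`. It suffices to compare `R/(J + f)` with
`R/(J + f')`, provided the hypotheses needed for this step survive the replacement of `f` by `f'`,
so that the elements can be perturbed one at a time.

*Comparison.* If `0 :_M f` has finite length, the long exact sequence of local cohomology breaks up
into short exact sequences `0 → H^i(M)/f H^i(M) → H^i(M/fM) → (0 :_{H^{i+1}(M)} f) → 0`
(`length_lc_of_exact_smul`). So the lengths of the `H^i(M/fM)` depend only on the action of `f` on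
the modules `H^i(M)`. By induction the lengths of these are bounded by the Buchsbaum invariant of
`R`, hence by `N`, and `ε` acts on them as zero (`lcLength_sup_span_le`, `lcLength_sup_span_eq`).
That the kernels of `f` and `f'` have finite length follows from `dim M/fM ≤ s` and
`dim M/f'M ≤ s`, where `s = d - r`, because the `H^i(M)` have finite length for `i ≤ s`
(`isFiniteLength_of_dimLT`). There is no need to know that `f'` is again a parameter.

*Survival.* It remains to show `dim M/f'M ≤ s` and that the multiplicity does not increase, in the
sense that the Hilbert-Samuel function of `M/f'M` has degree at most `s` with `s`-th difference at
most `e(R/I)`. For an element `f` let the `j`-th layer be the function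
`n ↦ ℓ((f m^n M + m^{n+j} M)/(f m^n M + m^{n+j+1} M))`. It is eventually polynomial by a
Hilbert-Serre argument (`exists_hasLead_colength`), and the sum of the layers with `j < a` is
`ℓ(m^n M/(f m^n M + m^{n+a} M))`, which is at most `ℓ(M/(fM + m^{n+a} M))`. So the first `N` layers
of `f` have nonnegative leading coefficients in degree `s` whose sum is at most the multiplicity of
`M/fM`, which is less than `N`. Hence one of them vanishes. Those first `N` layers coincide for `f`
and `f'`, and a layer bounds all later ones up to a shift. Thus all the sums of layers of `f'` have
leading coefficient at most `e(R/I)` (`exists_hasLead_mixedPow_sub`). If `M/f'M` had dimension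
greater than `s`, the sums of `a` layers would have leading coefficient at least `a`
(`ringKrullDim_lt_of_sub_mem`); and up to a bounded error they compute the Hilbert-Samuel function
of `M/f'M` (`exists_hasLead_samuel_of_sub_mem`).

Mathlib defines local cohomology as a colimit of `Ext` modules. The long exact sequence, the
identification of `H^0` with the torsion submodule and the vanishing on torsion modules are
developed here.
-/

noncomputable section

namespace GenCM

section Categories

open CategoryTheory Limits Category

/-! ### Long exact sequences of left derived functors -/

section Derived
variable {C : Type*} [Category* C] [Abelian C]
  {D : Type*} [Category* D] [Abelian D]
  {F G H : C ⥤ D} [F.Additive] [G.Additive] [H.Additive] (α : F ⟶ G) (β : G ⟶ H)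
  (w : α ≫ β = 0)

/-- The short complex of complexes obtained by applying `F ⟶ G ⟶ H` degreewise to a complex `P`. -/
abbrev resolutionShortComplex (P : ChainComplex C ℕ) : ShortComplex (ChainComplex D ℕ) :=
  ShortComplex.mk ((NatTrans.mapHomologicalComplex α _).app P)
    ((NatTrans.mapHomologicalComplex β _).app P) (by
      ext n
      exact congr_app w (P.X n))

variable (hex : ∀ (X : C) [Projective X],
  (ShortComplex.mk (α.app X) (β.app X) (congr_app w X)).ShortExact)

include hex in
theorem resolutionShortComplex_shortExact {X : C} (P : ProjectiveResolution X) :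
    (resolutionShortComplex α β w P.complex).ShortExact :=
  HomologicalComplex.shortExact_of_degreewise_shortExact _ (fun n => hex (P.complex.X n))

theorem down_rel (i : ℕ) : (ComplexShape.down ℕ).Rel (i + 1) i := rfl

/-- The connecting morphism in homology when `F ⟶ G ⟶ H` is short exact on projective objects and
is applied to a projective resolution. -/
def resolutionδ (i : ℕ) {X : C} (P : ProjectiveResolution X) :
    (H.mapHomologicalComplex _ ⋙ HomologicalComplex.homologyFunctor _ _ (i + 1)).obj P.complex ⟶
    (F.mapHomologicalComplex _ ⋙ HomologicalComplex.homologyFunctor _ _ i).obj P.complex :=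
  (resolutionShortComplex_shortExact α β w hex P).δ (i + 1) i (down_rel i)

theorem resolutionδ_naturality (i : ℕ) {X Y : C} (P : ProjectiveResolution X)
    (Q : ProjectiveResolution Y)
    (φ : P.complex ⟶ Q.complex) :
    resolutionδ α β w hex i P ≫
      (F.mapHomologicalComplex _ ⋙ HomologicalComplex.homologyFunctor _ _ i).map φ
    = (H.mapHomologicalComplex _ ⋙ HomologicalComplex.homologyFunctor _ _ (i + 1)).map φ ≫
      resolutionδ α β w hex i Q :=
  HomologicalComplex.HomologySequence.δ_naturality
    ({ τ₁ := (F.mapHomologicalComplex _).map φ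
       τ₂ := (G.mapHomologicalComplex _).map φ
       τ₃ := (H.mapHomologicalComplex _).map φ
       comm₁₂ := ((NatTrans.mapHomologicalComplex α _).naturality φ)
       comm₂₃ := ((NatTrans.mapHomologicalComplex β _).naturality φ) } :
        resolutionShortComplex α β w P.complex ⟶ resolutionShortComplex α β w Q.complex)
    (resolutionShortComplex_shortExact α β w hex P)
    (resolutionShortComplex_shortExact α β w hex Q) (i + 1) i (down_rel i)

omit [Abelian C] in
/-- Exactness of a pair of composable morphisms transfers along isomorphisms; that the composite
vanishes is part of the conclusion. -/
theorem exact_of_iso_of_comm {A B E A' B' E' : D} {f : A ⟶ B} {g : B ⟶ E} {w : f ≫ g = 0}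
    (h : (ShortComplex.mk f g w).Exact) (e₁ : A' ≅ A) (e₂ : B' ≅ B) (e₃ : E' ≅ E)
    {f' : A' ⟶ B'} {g' : B' ⟶ E'} (h₁ : f' ≫ e₂.hom = e₁.hom ≫ f)
    (h₂ : g' ≫ e₃.hom = e₂.hom ≫ g) :
    ∃ w', (ShortComplex.mk f' g' w').Exact := by
  have w' : f' ≫ g' = 0 := by
    rw [← cancel_mono e₃.hom, assoc, h₂, reassoc_of% h₁, w, comp_zero, zero_comp]
  exact ⟨w', (ShortComplex.exact_iff_of_iso
    (ShortComplex.isoMk e₁ e₂ e₃ h₁.symm h₂.symm)).2 h⟩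

variable [HasProjectiveResolutions C]

theorem leftDerived_app_comp_iso {X : C} (P : ProjectiveResolution X) (i : ℕ) :
    ((NatTrans.leftDerived α i).app X) ≫ (P.isoLeftDerivedObj G i).hom =
     (P.isoLeftDerivedObj F i).hom ≫ (HomologicalComplex.homologyFunctor D _ i).map
       ((NatTrans.mapHomologicalComplex α _).app P.complex) := by
  rw [P.leftDerived_app_eq α i, assoc, assoc, Iso.inv_hom_id, comp_id]

/-- The connecting transformation `L_{i+1} H ⟶ L_i F` attached to additive functors `F ⟶ G ⟶ H`
that form a short exact sequence on projective objects. -/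
def leftDerivedδ (i : ℕ) : H.leftDerived (i + 1) ⟶ F.leftDerived i where
  app X := ((projectiveResolution X).isoLeftDerivedObj H (i + 1)).hom ≫
    resolutionδ α β w hex i (projectiveResolution X) ≫
    ((projectiveResolution X).isoLeftDerivedObj F i).inv
  naturality X Y f := by
    let φ := ProjectiveResolution.lift f (projectiveResolution X) (projectiveResolution Y)
    have comm : φ.f 0 ≫ (projectiveResolution Y).π.f 0 = (projectiveResolution X).π.f 0 ≫ f :=
      ProjectiveResolution.lift_commutes_zero f _ _
    have h1 := ProjectiveResolution.isoLeftDerivedObj_hom_naturality f _ _ φ comm H (i+1)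
    have h2 := ProjectiveResolution.isoLeftDerivedObj_inv_naturality f _ _ φ comm F i
    have h3 := resolutionδ_naturality α β w hex i (projectiveResolution X)
      (projectiveResolution Y) φ
    rw [assoc, assoc, h2, ← assoc ((H.leftDerived (i + 1)).map f), h1, assoc,
      ← assoc (resolutionδ _ _ _ _ _ _), h3, assoc]

theorem leftDerivedδ_app_comp_iso (i : ℕ) (X : C) :
    (leftDerivedδ α β w hex i).app X ≫ ((projectiveResolution X).isoLeftDerivedObj F i).hom =
     ((projectiveResolution X).isoLeftDerivedObj H (i+1)).hom ≫
       resolutionδ α β w hex i (projectiveResolution X) := by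
  simp [leftDerivedδ]

theorem leftDerived_exact₁ (i : ℕ) (X : C) :
    ∃ w', (ShortComplex.mk ((leftDerivedδ α β w hex i).app X)
      ((NatTrans.leftDerived α i).app X) w').Exact :=
  exact_of_iso_of_comm
    ((resolutionShortComplex_shortExact α β w hex (projectiveResolution X)).homology_exact₁
      (i + 1) i (down_rel i))
    _ _ _ (leftDerivedδ_app_comp_iso α β w hex i X) (leftDerived_app_comp_iso α _ i)

include hex in
theorem leftDerived_exact₂ (i : ℕ) (X : C) :
    ∃ w', (ShortComplex.mk ((NatTrans.leftDerived α i).app X)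
      ((NatTrans.leftDerived β i).app X) w').Exact :=
  exact_of_iso_of_comm
    ((resolutionShortComplex_shortExact α β w hex (projectiveResolution X)).homology_exact₂ i)
    _ _ _ (leftDerived_app_comp_iso α _ i) (leftDerived_app_comp_iso β _ i)

theorem leftDerived_exact₃ (i : ℕ) (X : C) :
    ∃ w', (ShortComplex.mk ((NatTrans.leftDerived β (i + 1)).app X)
      ((leftDerivedδ α β w hex i).app X) w').Exact :=
  exact_of_iso_of_comm
    ((resolutionShortComplex_shortExact α β w hex (projectiveResolution X)).homology_exact₃
      (i + 1) i (down_rel i))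
    _ _ _ (leftDerived_app_comp_iso β _ (i + 1)) (leftDerivedδ_app_comp_iso α β w hex i X)
end Derived

/-! ### Connecting morphisms for `Ext` -/

section HomOp
variable {R : Type u} [CommRing R]

/-- The functor `Hom(-, M)`, as a covariant functor to the opposite category: local cohomology in
Mathlib is a colimit of the left derived functors of these. -/
abbrev homOp (M : ModuleCat.{u} R) : ModuleCat.{u} R ⥤ (ModuleCat.{u} R)ᵒᵖ :=
  ((linearYoneda R (ModuleCat.{u} R)).obj M).rightOp

/-- The transformation `Hom(-, M) ⟶ Hom(-, N)` induced by `M ⟶ N`, with values in the opposite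
category, where it points the other way. -/
abbrev homOpMap {M N : ModuleCat.{u} R} (f : M ⟶ N) : homOp N ⟶ homOp M :=
  NatTrans.rightOp ((linearYoneda R (ModuleCat.{u} R)).map f)

theorem homOp_shortExact {S : ShortComplex (ModuleCat.{u} R)} (hS : S.ShortExact)
    (X : ModuleCat.{u} R) [Projective X] :
    ∃ w, (ShortComplex.mk ((homOpMap S.g).app X) ((homOpMap S.f).app X) w).ShortExact := by
  have := hS.mono_f
  have := hS.epi_g
  let T : ShortComplex (ModuleCat.{u} R) :=
    ShortComplex.mk (((linearYoneda R (ModuleCat.{u} R)).map S.f).app (Opposite.op X))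
      (((linearYoneda R (ModuleCat.{u} R)).map S.g).app (Opposite.op X)) (by
        ext (φ : X ⟶ S.X₁)
        change (φ ≫ S.f) ≫ S.g = 0
        rw [assoc, S.zero, comp_zero])
  have hT : T.ShortExact :=
    { exact := by
        rw [ShortComplex.moduleCat_exact_iff]
        rintro (φ : X ⟶ S.X₂) (h : φ ≫ S.g = 0)
        exact ⟨hS.exact.lift φ h, hS.exact.lift_f φ h⟩
      mono_f := by
        rw [ModuleCat.mono_iff_injective]
        rintro (φ : X ⟶ S.X₁) (ψ : X ⟶ S.X₁) (h : φ ≫ S.f = ψ ≫ S.f)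
        exact (cancel_mono S.f).1 h
      epi_g := by
        rw [ModuleCat.epi_iff_surjective]
        rintro (φ : X ⟶ S.X₃)
        exact ⟨Projective.factorThru φ S.g, Projective.factorThru_comp φ S.g⟩ }
  exact ⟨_, hT.op⟩

theorem homOpMap_comp {S : ShortComplex (ModuleCat.{u} R)} : homOpMap S.g ≫ homOpMap S.f = 0 := by
  ext X
  apply Quiver.Hom.unop_inj
  ext (φ : X ⟶ S.X₁)
  change (φ ≫ S.f) ≫ S.g = 0
  rw [assoc, S.zero, comp_zero]

variable {S : ShortComplex (ModuleCat.{u} R)} (hS : S.ShortExact)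

/-- The connecting morphism `Ext^i(-, S.X₃) ⟶ Ext^{i+1}(-, S.X₁)` of a short exact sequence, seen
in the opposite category. -/
def extδ (i : ℕ) : (homOp S.X₁).leftDerived (i + 1) ⟶ (homOp S.X₃).leftDerived i :=
  leftDerivedδ (homOpMap S.g) (homOpMap S.f) homOpMap_comp (fun X _ => (homOp_shortExact hS X).2) i

/-- The connecting morphisms `Ext^i(R/J_n, S.X₃) ⟶ Ext^{i+1}(R/J_n, S.X₁)`, as a morphism between
the diagrams whose colimits are the local cohomology modules. -/
def diagramδ (J : ℕᵒᵖ ⥤ Ideal R) (i : ℕ) :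
    (localCohomology.diagram J i) ⋙ (evaluation _ _).obj S.X₃ ⟶
      (localCohomology.diagram J (i + 1)) ⋙ (evaluation _ _).obj S.X₁ where
  app n := ((extδ hS i).app (((localCohomology.ringModIdeals J).op.obj n).unop)).unop
  naturality n n' f := by
    apply Quiver.Hom.op_inj
    exact ((extδ hS i).naturality ((localCohomology.ringModIdeals J).map f.unop)).symm

theorem diagram_exact₁ (J : ℕᵒᵖ ⥤ Ideal R) (i : ℕ) (n : ℕᵒᵖᵒᵖ) :
    ∃ w, (ShortComplex.mk (((localCohomology.diagram J i).obj n).map S.g)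
      ((diagramδ hS J i).app n) w).Exact := by
  obtain ⟨w, h⟩ := leftDerived_exact₁ (homOpMap S.g) (homOpMap S.f) homOpMap_comp
    (fun X _ => (homOp_shortExact hS X).2) i (((localCohomology.ringModIdeals J).op.obj n).unop)
  exact ⟨_, h.unop⟩

include hS in
theorem diagram_exact₂ (J : ℕᵒᵖ ⥤ Ideal R) (i : ℕ) (n : ℕᵒᵖᵒᵖ) :
    ∃ w, (ShortComplex.mk (((localCohomology.diagram J i).obj n).map S.f)
      (((localCohomology.diagram J i).obj n).map S.g)  w).Exact := by
  obtain ⟨w, h⟩ := leftDerived_exact₂ (homOpMap S.g) (homOpMap S.f) homOpMap_comp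
    (fun X _ => (homOp_shortExact hS X).2) i (((localCohomology.ringModIdeals J).op.obj n).unop)
  exact ⟨_, h.unop⟩

theorem diagram_exact₃ (J : ℕᵒᵖ ⥤ Ideal R) (i : ℕ) (n : ℕᵒᵖᵒᵖ) :
    ∃ w, (ShortComplex.mk ((diagramδ hS J i).app n)
      (((localCohomology.diagram J (i + 1)).obj n).map S.f) w).Exact := by
  obtain ⟨w, h⟩ := leftDerived_exact₃ (homOpMap S.g) (homOpMap S.f) homOpMap_comp
    (fun X _ => (homOp_shortExact hS X).2) i (((localCohomology.ringModIdeals J).op.obj n).unop)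
  exact ⟨_, h.unop⟩

/-- The endomorphism of an object of the opposite category of modules given by a scalar. -/
def opSMul (x : R) (Z : (ModuleCat.{u} R)ᵒᵖ) : Z ⟶ Z := (x • 𝟙 Z.unop).op

theorem opSMul_comp (x : R) {Z W : (ModuleCat.{u} R)ᵒᵖ} (h : Z ⟶ W) :
    opSMul x Z ≫ h = h ≫ opSMul x W := by
  apply Quiver.Hom.unop_inj
  simp [opSMul]

/-- A chain map that is multiplication by `x` in each degree is multiplication by `x` on homology.
In the opposite category there is no linear structure to refer to, hence `opSMul`. -/
theorem homologyMap_eq_opSMul (x : R) {K : ChainComplex (ModuleCat.{u} R)ᵒᵖ ℕ} (Φ : K ⟶ K)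
    (hΦ : ∀ n, Φ.f n = opSMul x (K.X n)) (i : ℕ) :
    HomologicalComplex.homologyMap Φ i = opSMul x (K.homology i) := by
  have h1 : HomologicalComplex.cyclesMap Φ i = opSMul x (K.cycles i) := by
    rw [← cancel_mono (K.iCycles i), HomologicalComplex.cyclesMap_i, hΦ, opSMul_comp]
  rw [← cancel_epi (K.homologyπ i), HomologicalComplex.homologyπ_naturality, h1, opSMul_comp]

theorem leftDerived_homOpMap_smul (x : R) (M X : ModuleCat.{u} R) (i : ℕ) :
    (NatTrans.leftDerived (homOpMap (x • 𝟙 M)) i).app X =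
      opSMul x (((homOp M).leftDerived i).obj X) := by
  rw [← cancel_mono ((projectiveResolution X).isoLeftDerivedObj (homOp M) i).hom,
    leftDerived_app_comp_iso, opSMul_comp]
  congr 1
  refine homologyMap_eq_opSMul x _ (fun n => ?_) i
  apply Quiver.Hom.unop_inj
  ext (φ : (projectiveResolution X).complex.X n ⟶ M)
  change φ ≫ (x • 𝟙 M) = x • φ
  simp

theorem diagram_map_smul_id (J : ℕᵒᵖ ⥤ Ideal R) (i : ℕ) (n : ℕᵒᵖᵒᵖ) (x : R)
    (M : ModuleCat.{u} R) :
    ((localCohomology.diagram J i).obj n).map (x • 𝟙 M) =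
      x • 𝟙 (((localCohomology.diagram J i).obj n).obj M) :=
  congrArg Quiver.Hom.unop
    (leftDerived_homOpMap_smul x M (((localCohomology.ringModIdeals J).op.obj n).unop) i)

/-- The colimit cocone of local cohomology functors, evaluated at a module `M`. -/
def lcCocone (J : ℕᵒᵖ ⥤ Ideal R) (i : ℕ) (M : ModuleCat.{u} R) :
    Cocone ((localCohomology.diagram J i) ⋙ (evaluation _ _).obj M) :=
  ((evaluation _ _).obj M).mapCocone (colimit.cocone (localCohomology.diagram J i))

/-- Colimits of functors are computed objectwise, so `lcCocone` is a colimit cocone. -/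
def lcIsColimit (J : ℕᵒᵖ ⥤ Ideal R) (i : ℕ) (M : ModuleCat.{u} R) :
    IsColimit (lcCocone J i M) :=
  isColimitOfPreserves _ (colimit.isColimit (localCohomology.diagram J i))

/-- The universe-`0` case covers colimits over `ℕᵒᵖᵒᵖ`. -/
instance : PreservesFilteredColimitsOfSize.{0, 0} (forget (ModuleCat.{u} R)) :=
  preservesFilteredColimitsOfSize_shrink.{0, u, 0, u} _

/-- Filtered colimits of modules are exact, in terms of arbitrary colimit cocones over `ℕᵒᵖᵒᵖ`. -/
theorem colim_exact {A B E : ℕᵒᵖᵒᵖ ⥤ ModuleCat.{u} R} {a : A ⟶ B} {b : B ⟶ E}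
    {cA : Cocone A} {cB : Cocone B} {cE : Cocone E} (hA : IsColimit cA) (hB : IsColimit cB)
    (hE : IsColimit cE) (p : cA.pt ⟶ cB.pt) (q : cB.pt ⟶ cE.pt)
    (hp : ∀ n, cA.ι.app n ≫ p = a.app n ≫ cB.ι.app n)
    (hq : ∀ n, cB.ι.app n ≫ q = b.app n ≫ cE.ι.app n)
    (hex : ∀ n, ∃ w, (ShortComplex.mk (a.app n) (b.app n) w).Exact) :
    Function.Exact p.hom q.hom := by
  have hp' : ∀ n x, p.hom (cA.ι.app n x) = cB.ι.app n (a.app n x) := fun n x =>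
    congrArg (fun f => f.hom x) (hp n)
  have hq' : ∀ n x, q.hom (cB.ι.app n x) = cE.ι.app n (b.app n x) := fun n x =>
    congrArg (fun f => f.hom x) (hq n)
  intro y
  constructor
  · intro hy
    obtain ⟨n, y, rfl⟩ := Concrete.isColimit_exists_rep _ hB y
    rw [hq'] at hy
    obtain ⟨k, f, g, h⟩ := (Concrete.isColimit_rep_eq_iff_exists _ hE (b.app n y)
      (0 : E.obj n)).1 (by rw [hy, map_zero])
    rw [map_zero] at h
    have h2 : b.app k (B.map f y) = 0 := by
      rw [← h]
      exact congrArg (fun f => f.hom y) (b.naturality f)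
    obtain ⟨w, hk⟩ := hex k
    obtain ⟨x, hx⟩ := (ShortComplex.moduleCat_exact_iff _).1 hk _ h2
    refine ⟨cA.ι.app k x, ?_⟩
    rw [hp']
    have : (a.app k) x = B.map f y := hx
    rw [this]
    exact congrArg (fun f => f.hom y) (cB.w f)
  · rintro ⟨x, rfl⟩
    obtain ⟨n, x, rfl⟩ := Concrete.isColimit_exists_rep _ hA x
    obtain ⟨w, hk⟩ := hex n
    rw [hp', hq']
    have : b.app n (a.app n x) = 0 := congrArg (fun f => f.hom x) w
    rw [this, map_zero]

end HomOp

/-! ### Local cohomology as a cohomological functor -/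

section LCInterface
variable {R : Type u} [CommRing R] (I : Ideal R) (i : ℕ)
  {A B E : Type u} [AddCommGroup A] [Module R A] [AddCommGroup B] [Module R B]
  [AddCommGroup E] [Module R E]

/-- The local cohomology module `H^i_I(M)` of an unbundled module `M`. For `I` the maximal ideal of
a local ring this is definitionally `LC R i M`. -/
abbrev lc (M : Type u) [AddCommGroup M] [Module R M] : ModuleCat.{u} R :=
  (localCohomology I i).obj (ModuleCat.of R M)

/-- The map `H^i_I(A) → H^i_I(B)` induced by a linear map `A → B`. -/
def lcMap (f : A →ₗ[R] B) : lc I i A →ₗ[R] lc I i B :=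
  ((localCohomology I i).map (ModuleCat.ofHom f)).hom

theorem lcMap_id : lcMap I i (LinearMap.id : A →ₗ[R] A) = LinearMap.id := by
  rw [lcMap, ModuleCat.ofHom_id, CategoryTheory.Functor.map_id]; rfl

theorem lcMap_comp (g : B →ₗ[R] E) (f : A →ₗ[R] B) :
    lcMap I i (g ∘ₗ f) = lcMap I i g ∘ₗ lcMap I i f := by
  rw [lcMap, ModuleCat.ofHom_comp, Functor.map_comp]; rfl

/-- Isomorphic modules have isomorphic local cohomology. -/
def lcEquiv (e : A ≃ₗ[R] B) : lc I i A ≃ₗ[R] lc I i B :=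
  LinearEquiv.ofLinearMap (lcMap I i e) (lcMap I i e.symm)
    (by rw [← lcMap_comp]; simp [lcMap_id]) (by rw [← lcMap_comp]; simp [lcMap_id])

/-- `lcMap` is compatible with the structure maps of the colimit. -/
theorem lcMap_compat (f : A →ₗ[R] B) (n : ℕᵒᵖᵒᵖ) :
    (lcCocone (localCohomology.idealPowersDiagram I) i (ModuleCat.of R A)).ι.app n ≫
      (localCohomology I i).map (ModuleCat.ofHom f) =
    ((localCohomology.diagram (localCohomology.idealPowersDiagram I) i).obj n).map
      (ModuleCat.ofHom f) ≫
      (lcCocone (localCohomology.idealPowersDiagram I) i (ModuleCat.of R B)).ι.app n :=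
  (((colimit.cocone (localCohomology.diagram (localCohomology.idealPowersDiagram I) i)).ι.app
    n).naturality (ModuleCat.ofHom f)).symm

/-- Multiplication by `x` on `A` induces multiplication by `x` on `H^i_I(A)`. -/
theorem lcMap_smul_id (x : R) :
    lcMap I i (x • (LinearMap.id : A →ₗ[R] A)) = x • LinearMap.id := by
  ext y
  obtain ⟨n, y, rfl⟩ := Concrete.isColimit_exists_rep _
    (lcIsColimit (localCohomology.idealPowersDiagram I) i (ModuleCat.of R A)) y
  refine (congrArg (fun f => f.hom y)
    (lcMap_compat I i (x • (LinearMap.id : A →ₗ[R] A)) n)).trans ?_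
  have h2 := congrArg (fun f => f.hom y)
    (diagram_map_smul_id (localCohomology.idealPowersDiagram I) i n x (ModuleCat.of R A))
  refine (congrArg ((lcCocone (localCohomology.idealPowersDiagram I) i
    (ModuleCat.of R A)).ι.app n).hom h2).trans ?_
  exact map_smul ((lcCocone (localCohomology.idealPowersDiagram I) i
    (ModuleCat.of R A)).ι.app n).hom x y

/-- An exact pair of linear maps as a short complex of modules. -/
abbrev sesOf {f : A →ₗ[R] B} {g : B →ₗ[R] E} (h : Function.Exact f g) :
    ShortComplex (ModuleCat.{u} R) :=
  ShortComplex.mk (ModuleCat.ofHom f) (ModuleCat.ofHom g) (by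
    ext x; exact h.apply_apply_eq_zero x)

theorem sesOf_shortExact {f : A →ₗ[R] B} {g : B →ₗ[R] E} (hf : Function.Injective f)
    (h : Function.Exact f g) (hg : Function.Surjective g) : (sesOf h).ShortExact where
  exact := by
    rw [ShortComplex.moduleCat_exact_iff]
    exact fun x hx => (h x).1 hx
  mono_f := (ModuleCat.mono_iff_injective _).2 hf
  epi_g := (ModuleCat.epi_iff_surjective _).2 hg

variable {f : A →ₗ[R] B} {g : B →ₗ[R] E} (hf : Function.Injective f)
    (h : Function.Exact f g) (hg : Function.Surjective g)

/-- The connecting morphism of local cohomology as a morphism between the points of the colimit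
cocones. -/
def lcδAux : (lcCocone (localCohomology.idealPowersDiagram I) i (ModuleCat.of R E)).pt ⟶
    (lcCocone (localCohomology.idealPowersDiagram I) (i + 1) (ModuleCat.of R A)).pt :=
  IsColimit.map (lcIsColimit _ i _) _ (diagramδ (sesOf_shortExact hf h hg) _ i)

/-- The connecting map `H^i_I(E) → H^{i+1}_I(A)` of a short exact sequence `0 → A → B → E → 0`. -/
def lcδ : lc I i E →ₗ[R] lc I (i + 1) A := (lcδAux I i hf h hg).hom

/-- The map of diagrams `Ext^i(R/I^n, A) → Ext^i(R/I^n, B)` induced by a linear map `A → B`. -/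
def diagramMap (f : A →ₗ[R] B) :
    (localCohomology.diagram (localCohomology.idealPowersDiagram I) i) ⋙
      (evaluation _ _).obj (ModuleCat.of R A) ⟶
    (localCohomology.diagram (localCohomology.idealPowersDiagram I) i) ⋙
      (evaluation _ _).obj (ModuleCat.of R B) :=
  Functor.whiskerLeft _ ((evaluation _ _).map (ModuleCat.ofHom f))

theorem lc_exact₁ : Function.Exact (lcMap I i g) (lcδ I i hf h hg) :=
  colim_exact (a := diagramMap I i g) (b := diagramδ (sesOf_shortExact hf h hg) _ i)
    (lcIsColimit _ i _) (lcIsColimit _ i _) (lcIsColimit _ (i + 1) _)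
    ((localCohomology I i).map (ModuleCat.ofHom g)) (lcδAux I i hf h hg)
    (lcMap_compat I i g) (fun _ => (lcIsColimit _ i _).ι_map _ _ _)
    (fun n => diagram_exact₁ (sesOf_shortExact hf h hg) _ i n)

include hf h hg in
theorem lc_exact₂ : Function.Exact (lcMap I i f) (lcMap I i g) :=
  colim_exact (a := diagramMap I i f) (b := diagramMap I i g)
    (lcIsColimit _ i _) (lcIsColimit _ i _) (lcIsColimit _ i _)
    ((localCohomology I i).map (ModuleCat.ofHom f)) ((localCohomology I i).map (ModuleCat.ofHom g))
    (lcMap_compat I i f) (lcMap_compat I i g)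
    (fun n => diagram_exact₂ (sesOf_shortExact hf h hg) _ i n)

theorem lc_exact₃ : Function.Exact (lcδ I i hf h hg) (lcMap I (i + 1) f) :=
  colim_exact (a := diagramδ (sesOf_shortExact hf h hg) _ i) (b := diagramMap I (i + 1) f)
    (lcIsColimit _ i _) (lcIsColimit _ (i + 1) _) (lcIsColimit _ (i + 1) _)
    (lcδAux I i hf h hg) ((localCohomology I (i + 1)).map (ModuleCat.ofHom f))
    (fun _ => (lcIsColimit _ i _).ι_map _ _ _) (lcMap_compat I (i + 1) f)
    (fun n => diagram_exact₃ (sesOf_shortExact hf h hg) _ i n)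

end LCInterface

/-! ### Local cohomology in degree zero and of injective modules -/

section DegreeZero
variable {R : Type u} [CommRing R]

/-- `Ext^{i+1}(X, E) = 0` for `E` injective. -/
theorem isZero_leftDerived_homOp_of_injective (E X : ModuleCat.{u} R) [Injective E] (i : ℕ) :
    IsZero (((homOp E).leftDerived (i + 1)).obj X) := by
  let P := projectiveResolution X
  refine IsZero.of_iso ?_ (P.isoLeftDerivedObj (homOp E) (i + 1))
  refine (HomologicalComplex.exactAt_iff_isZero_homology _ _).1 ?_
  rw [HomologicalComplex.exactAt_iff' _ (i + 2) (i + 1) i (by simp) (by simp)]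
  have hP := (HomologicalComplex.exactAt_iff' _ (i + 2) (i + 1) i (by simp) (by simp)).1
    (P.complex_exactAt_succ i)
  let T : ShortComplex (ModuleCat.{u} R) :=
    ShortComplex.mk (((linearYoneda R _).obj E).map (P.complex.d (i + 1) i).op)
      (((linearYoneda R _).obj E).map (P.complex.d (i + 2) (i + 1)).op) (by
        rw [← Functor.map_comp, ← op_comp, HomologicalComplex.d_comp_d, op_zero]
        exact Functor.map_zero _ _ _)
  have hT : T.Exact := by
    rw [ShortComplex.moduleCat_exact_iff]
    rintro (φ : P.complex.X (i + 1) ⟶ E) (h : P.complex.d (i + 2) (i + 1) ≫ φ = 0)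
    exact ⟨hP.descToInjective φ h, hP.comp_descToInjective φ h⟩
  exact hT.op

instance (M : ModuleCat.{u} R) : PreservesFiniteColimits (homOp M) := by
  have : PreservesLimits (((linearYoneda R (ModuleCat.{u} R)).obj M) ⋙ forget _) :=
    (inferInstance : PreservesLimits (yoneda.obj M))
  have : PreservesLimits ((linearYoneda R (ModuleCat.{u} R)).obj M) :=
    preservesLimits_of_reflects_of_preserves _ (forget _)
  exact preservesFiniteColimits_rightOp _

theorem comp_eq_comp_of_squares {V : Type*} [Category* V] {A B E A' B' E' : V}
    {a : A ⟶ A'} {b : B ⟶ B'} {e : E ⟶ E'} {p : A ⟶ B} {q : B ⟶ E} {p' : A' ⟶ B'} {q' : B' ⟶ E'}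
    (h₁ : a ≫ p' = p ≫ b) (h₂ : b ≫ q' = q ≫ e) : a ≫ p' ≫ q' = (p ≫ q) ≫ e := by
  rw [reassoc_of% h₁, h₂, assoc]

theorem fromLeftDerivedZero_naturality {M N : ModuleCat.{u} R} (f : M ⟶ N) (X : ModuleCat.{u} R) :
    (NatTrans.leftDerived (homOpMap f) 0).app X ≫ (homOp M).fromLeftDerivedZero.app X =
      (homOp N).fromLeftDerivedZero.app X ≫ (homOpMap f).app X := by
  let P := projectiveResolution X
  rw [P.fromLeftDerivedZero_eq, P.fromLeftDerivedZero_eq, ← assoc, leftDerived_app_comp_iso,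
    assoc, assoc]
  congr 1
  have h1 : (HomologicalComplex.homologyFunctor _ _ 0).map
      ((NatTrans.mapHomologicalComplex (homOpMap f) (ComplexShape.down ℕ)).app P.complex) ≫
      (ChainComplex.isoHomologyι₀ _).hom = (ChainComplex.isoHomologyι₀ _).hom ≫
      HomologicalComplex.opcyclesMap
        ((NatTrans.mapHomologicalComplex (homOpMap f) (ComplexShape.down ℕ)).app P.complex) 0 :=
    HomologicalComplex.homologyι_naturality _ _
  have h2 : HomologicalComplex.opcyclesMap
        ((NatTrans.mapHomologicalComplex (homOpMap f) (ComplexShape.down ℕ)).app P.complex) 0 ≫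
      P.fromLeftDerivedZero' (homOp M) = P.fromLeftDerivedZero' (homOp N) ≫ (homOpMap f).app X := by
    rw [← cancel_epi (HomologicalComplex.pOpcycles _ _), HomologicalComplex.p_opcyclesMap_assoc,
      P.pOpcycles_comp_fromLeftDerivedZero', ← assoc, P.pOpcycles_comp_fromLeftDerivedZero']
    exact ((homOpMap f).naturality (P.π.f 0)).symm
  exact comp_eq_comp_of_squares h1 h2

variable (I : Ideal R)

/-- The diagram of the functors `Ext^i(R/I^n, -)`. -/
abbrev powDiagram (i : ℕ) : ℕᵒᵖᵒᵖ ⥤ ModuleCat.{u} R ⥤ ModuleCat.{u} R :=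
  localCohomology.diagram (localCohomology.idealPowersDiagram I) i

/-- The diagram of the modules `R/I^n`. -/
abbrev powQuotients : ℕᵒᵖ ⥤ ModuleCat.{u} R :=
  localCohomology.ringModIdeals (localCohomology.idealPowersDiagram I)

/-- Evaluation at `1` of a homomorphism `R/I^n ⟶ M`. -/
def homEval (M : ModuleCat.{u} R) (n : ℕᵒᵖᵒᵖ) :
    ((homOp M).obj ((powQuotients I).op.obj n).unop).unop ⟶ M :=
  ModuleCat.ofHom (Y := M)
    { toFun := fun (φ : ((powQuotients I).op.obj n).unop ⟶ M) => φ (Submodule.Quotient.mk (1 : R))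
      map_add' := fun _ _ => rfl
      map_smul' := fun _ _ => rfl }

theorem homEval_injective (M : ModuleCat.{u} R) (n : ℕᵒᵖᵒᵖ) :
    Function.Injective (homEval I M n) := by
  rintro (φ : ((powQuotients I).op.obj n).unop ⟶ M) (ψ : ((powQuotients I).op.obj n).unop ⟶ M)
    (h : φ (Submodule.Quotient.mk (1 : R)) = ψ (Submodule.Quotient.mk (1 : R)))
  apply ModuleCat.hom_ext
  refine LinearMap.ext fun y => ?_
  obtain ⟨a, rfl⟩ := Submodule.Quotient.mk_surjective _ y
  have : (Submodule.Quotient.mk a : R ⧸ _) =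
      a • (Submodule.Quotient.mk (1 : R) : R ⧸ I ^ n.unop.unop) := by
    rw [← Submodule.Quotient.mk_smul, smul_eq_mul, mul_one]
  have e1 := φ.hom.map_smul a (Submodule.Quotient.mk (1 : R))
  have e2 := ψ.hom.map_smul a (Submodule.Quotient.mk (1 : R))
  have h' := congrArg (a • ·) h
  exact (congrArg φ.hom this).trans ((e1.trans (h'.trans e2.symm)).trans (congrArg ψ.hom this).symm)

theorem exists_homEval_eq (M : ModuleCat.{u} R) (n : ℕᵒᵖᵒᵖ) (m : M)
    (hm : ∀ a ∈ I ^ n.unop.unop, a • m = 0) : ∃ φ, homEval I M n φ = m := by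
  refine ⟨(ModuleCat.ofHom (Submodule.liftQ (I ^ n.unop.unop) (LinearMap.toSpanSingleton R M m)
    (fun a ha => hm a ha)) : ((powQuotients I).op.obj n).unop ⟶ M), ?_⟩
  exact one_smul R m

theorem smul_homEval_eq_zero (M : ModuleCat.{u} R) (n : ℕᵒᵖᵒᵖ) (φ) (a : R)
    (ha : a ∈ I ^ n.unop.unop) : a • homEval I M n φ = 0 := by
  let ψ : ((powQuotients I).op.obj n).unop ⟶ M := φ
  refine (ψ.hom.map_smul a (Submodule.Quotient.mk (1 : R))).symm.trans ?_
  have : a • (Submodule.Quotient.mk (1 : R) : R ⧸ I ^ n.unop.unop) = 0 := by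
    rw [← Submodule.Quotient.mk_smul, smul_eq_mul, mul_one]
    exact (Submodule.Quotient.mk_eq_zero _).2 ha
  exact (congrArg ψ.hom this).trans (map_zero _)

/-- The evaluation at `1`, precomposed with `Ext^0(R/I^n, M) ≅ Hom(R/I^n, M)`. -/
def diagramEval (M : ModuleCat.{u} R) (n : ℕᵒᵖᵒᵖ) : ((powDiagram I 0).obj n).obj M ⟶ M :=
  ((homOp M).leftDerivedZeroIsoSelf.inv.app (((powQuotients I).op.obj n).unop)).unop ≫ homEval I M n

theorem diagramEval_injective (M : ModuleCat.{u} R) (n : ℕᵒᵖᵒᵖ) :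
    Function.Injective (diagramEval I M n) := by
  have h1 : Function.Injective
      (((homOp M).leftDerivedZeroIsoSelf.inv.app (((powQuotients I).op.obj n).unop)).unop) :=
    (ModuleCat.mono_iff_injective _).1 inferInstance
  exact (homEval_injective I M n).comp h1

theorem exists_diagramEval_eq (M : ModuleCat.{u} R) (n : ℕᵒᵖᵒᵖ) (m : M)
    (hm : ∀ a ∈ I ^ n.unop.unop, a • m = 0) : ∃ y, diagramEval I M n y = m := by
  obtain ⟨φ, hφ⟩ := exists_homEval_eq I M n m hm
  have h1 : Function.Surjective
      (((homOp M).leftDerivedZeroIsoSelf.inv.app (((powQuotients I).op.obj n).unop)).unop) :=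
    (ModuleCat.epi_iff_surjective _).1 inferInstance
  obtain ⟨y, rfl⟩ := h1 φ
  exact ⟨y, hφ⟩

theorem diagramEval_map {M N : ModuleCat.{u} R} (f : M ⟶ N) (n : ℕᵒᵖᵒᵖ) :
    ((powDiagram I 0).obj n).map f ≫ diagramEval I N n = diagramEval I M n ≫ f := by
  have h := fromLeftDerivedZero_naturality f (((powQuotients I).op.obj n).unop)
  have h2 : (homOp N).leftDerivedZeroIsoSelf.inv.app (((powQuotients I).op.obj n).unop) ≫
      (NatTrans.leftDerived (homOpMap f) 0).app _ =
      (homOpMap f).app _ ≫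
        (homOp M).leftDerivedZeroIsoSelf.inv.app (((powQuotients I).op.obj n).unop) := by
    rw [← cancel_mono ((homOp M).fromLeftDerivedZero.app _), assoc, assoc, h,
      Functor.leftDerivedZeroIsoSelf_inv_hom_id_app, comp_id,
      Functor.leftDerivedZeroIsoSelf_inv_hom_id_app_assoc]
  have h3 := congrArg Quiver.Hom.unop h2
  have h4 : ((homOpMap f).app (((powQuotients I).op.obj n).unop)).unop ≫ homEval I N n =
      homEval I M n ≫ f := rfl
  exact comp_eq_comp_of_squares h3 h4

theorem diagramEval_naturality (M : ModuleCat.{u} R) {n n' : ℕᵒᵖᵒᵖ} (f : n ⟶ n') :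
    ((powDiagram I 0).map f).app M ≫ diagramEval I M n' = diagramEval I M n := by
  have h := congrArg Quiver.Hom.unop
    ((homOp M).leftDerivedZeroIsoSelf.inv.naturality ((powQuotients I).map f.unop))
  have h4 : ((homOp M).map ((powQuotients I).map f.unop)).unop ≫ homEval I M n' =
      homEval I M n := rfl
  rw [diagramEval, diagramEval, ← h4]
  exact congrArg (· ≫ homEval I M n') h.symm

variable {M N : Type u} [AddCommGroup M] [Module R M] [AddCommGroup N] [Module R N]

/-- The map `H^0_I(M) ⟶ M` glued from the evaluations `diagramEval`. -/
def lcEvalAux (M : ModuleCat.{u} R) :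
    (lcCocone (localCohomology.idealPowersDiagram I) 0 M).pt ⟶ M :=
  (lcIsColimit _ 0 M).desc
    { pt := M
      ι := { app := fun n => diagramEval I M n
             naturality := fun _ _ f => (diagramEval_naturality I M f).trans (comp_id _).symm } }

theorem lcEvalAux_fac (M : ModuleCat.{u} R) (n : ℕᵒᵖᵒᵖ) :
    (lcCocone (localCohomology.idealPowersDiagram I) 0 M).ι.app n ≫ lcEvalAux I M =
      diagramEval I M n := (lcIsColimit _ 0 M).fac _ n

theorem lcEvalAux_apply (M : ModuleCat.{u} R) (n : ℕᵒᵖᵒᵖ) (y) :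
    (lcEvalAux I M).hom ((lcCocone (localCohomology.idealPowersDiagram I) 0 M).ι.app n y) =
      diagramEval I M n y :=
  congrArg (fun f => f.hom y) (lcEvalAux_fac I M n)

/-- The canonical map `H^0_I(M) → M`. It is injective, and its image consists of the elements
killed by a power of `I`. -/
def lcEval (M : Type u) [AddCommGroup M] [Module R M] : lc I 0 M →ₗ[R] M :=
  (lcEvalAux I (ModuleCat.of R M)).hom

theorem lcEval_injective : Function.Injective (lcEval I M) := by
  rw [injective_iff_map_eq_zero]
  intro y hy
  obtain ⟨n, y, rfl⟩ := Concrete.isColimit_exists_rep _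
    (lcIsColimit (localCohomology.idealPowersDiagram I) 0 (ModuleCat.of R M)) y
  have h : diagramEval I (ModuleCat.of R M) n y = 0 := (lcEvalAux_apply I _ n y).symm.trans hy
  rw [diagramEval_injective I _ n (h.trans (map_zero _).symm)]
  exact map_zero _

theorem mem_range_lcEval (m : M) :
    m ∈ LinearMap.range (lcEval I M) ↔ ∃ n : ℕ, ∀ a ∈ I ^ n, a • m = 0 := by
  constructor
  · rintro ⟨y, rfl⟩
    obtain ⟨n, y, rfl⟩ := Concrete.isColimit_exists_rep _
      (lcIsColimit (localCohomology.idealPowersDiagram I) 0 (ModuleCat.of R M)) y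
    refine ⟨n.unop.unop, fun a ha => ?_⟩
    refine (congrArg (a • ·) (lcEvalAux_apply I _ n y)).trans ?_
    exact smul_homEval_eq_zero I (ModuleCat.of R M) n _ a ha
  · rintro ⟨n, hn⟩
    obtain ⟨y, hy⟩ := exists_diagramEval_eq I (ModuleCat.of R M) (Opposite.op (Opposite.op n)) m hn
    exact ⟨_, (lcEvalAux_apply I _ _ y).trans hy⟩

theorem lcEval_lcMap (f : M →ₗ[R] N) (y : lc I 0 M) :
    lcEval I N (lcMap I 0 f y) = f (lcEval I M y) := by
  obtain ⟨n, y, rfl⟩ := Concrete.isColimit_exists_rep _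
    (lcIsColimit (localCohomology.idealPowersDiagram I) 0 (ModuleCat.of R M)) y
  have h1 := congrArg (fun f => f.hom y) (lcMap_compat I 0 f n)
  have h2 := lcEvalAux_apply I (ModuleCat.of R M) n y
  have h3 := lcEvalAux_apply I (ModuleCat.of R N) n
    (((powDiagram I 0).obj n).map (ModuleCat.ofHom f) y)
  have h4 := congrArg (fun f => f.hom y) (diagramEval_map I (ModuleCat.ofHom f) n)
  refine (congrArg (lcEval I N) h1).trans (h3.trans (h4.trans ?_))
  exact congrArg f h2.symm

theorem lc_subsingleton_of_injective [Module.Injective R M] (i : ℕ) :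
    Subsingleton (lc I (i + 1) M) := by
  refine subsingleton_of_forall_eq 0 fun y => ?_
  obtain ⟨n, y, rfl⟩ := Concrete.isColimit_exists_rep _
    (lcIsColimit (localCohomology.idealPowersDiagram I) (i + 1) (ModuleCat.of R M)) y
  have : Injective (ModuleCat.of R M) := Module.injective_object_of_injective_module R M
  have h := isZero_leftDerived_homOp_of_injective (ModuleCat.of R M)
    (((powQuotients I).op.obj n).unop) i
  have h2 := ModuleCat.subsingleton_of_isZero h.unop
  have : y = 0 := h2.elim _ _
  rw [this]
  exact map_zero _

end DegreeZero

end Categories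

/-! ### Power torsion modules -/

section Torsion
variable {R : Type u} [CommRing R] (I : Ideal R)

/-- The `I`-power torsion submodule of `M`. -/
def powTorsion (M : Type u) [AddCommGroup M] [Module R M] : Submodule R M where
  carrier := {m | ∃ n : ℕ, ∀ a ∈ I ^ n, a • m = 0}
  zero_mem' := ⟨0, by simp⟩
  add_mem' := by
    rintro a b ⟨n, hn⟩ ⟨k, hk⟩
    refine ⟨n + k, fun c hc => ?_⟩
    rw [smul_add, hn c (Ideal.pow_le_pow_right (by omega) hc),
      hk c (Ideal.pow_le_pow_right (by omega) hc), add_zero]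
  smul_mem' := by
    rintro c x ⟨n, hn⟩
    exact ⟨n, fun a ha => by rw [smul_comm, hn a ha, smul_zero]⟩

/-- Every element of `M` is killed by a power of `I`. -/
def IsPowTorsion (M : Type u) [AddCommGroup M] [Module R M] : Prop :=
  ∀ m : M, ∃ n : ℕ, ∀ a ∈ I ^ n, a • m = 0

variable {M N E : Type u} [AddCommGroup M] [Module R M] [AddCommGroup N] [Module R N]
  [AddCommGroup E] [Module R E]

theorem isPowTorsion_powTorsion : IsPowTorsion I (powTorsion I M) := by
  rintro ⟨m, n, hn⟩
  exact ⟨n, fun a ha => Subtype.ext (hn a ha)⟩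

variable {I} in
theorem IsPowTorsion.of_surjective {f : M →ₗ[R] N} (hM : IsPowTorsion I M)
    (hf : Function.Surjective f) : IsPowTorsion I N := by
  intro y
  obtain ⟨x, rfl⟩ := hf y
  obtain ⟨n, hn⟩ := hM x
  exact ⟨n, fun a ha => by rw [← map_smul, hn a ha, map_zero]⟩

/-- The `I`-power torsion of an injective module is injective: in the setting of Baer's criterion,
the Artin-Rees lemma lets one extend a map from an ideal `J` first to `R/I^{n+k}`. -/
theorem injective_powTorsion [IsNoetherianRing R] [Module.Injective R M] :
    Module.Injective R (powTorsion I M) := by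
  apply Module.Baer.injective
  intro J g
  -- `g` is killed by a power of `I` since `J` is finitely generated
  have h1 : ∃ n : ℕ, ∀ a ∈ I ^ n, ∀ x, a • g x = 0 := by
    obtain ⟨s, hs⟩ := (isNoetherian_def.1 (inferInstance : IsNoetherian R J)) ⊤
    choose k hk using fun x : J => isPowTorsion_powTorsion (M := M) I (g x)
    refine ⟨s.sup k, fun a ha x => ?_⟩
    have hx : x ∈ Submodule.span R (s : Set J) := hs ▸ Submodule.mem_top
    induction hx using Submodule.span_induction with
    | mem x hx => exact hk x a (Ideal.pow_le_pow_right (Finset.le_sup hx) ha)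
    | zero => simp
    | add x y _ _ hx hy => rw [map_add, smul_add, hx, hy, add_zero]
    | smul c x _ hx => rw [map_smul, smul_comm, hx, smul_zero]
  obtain ⟨n, hn⟩ := h1
  obtain ⟨k, hk⟩ := Ideal.exists_pow_inf_eq_pow_smul I (J : Submodule R R)
  have hk' : I ^ (n + k) ⊓ J ≤ I ^ n • J := by
    have := hk (n + k) (by omega)
    simp only [smul_eq_mul, Ideal.mul_top, Nat.add_sub_cancel] at this
    rw [this]
    exact Ideal.mul_mono_right inf_le_right
  -- `g` vanishes on `I ^ (n + k) ⊓ J`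
  have hzero : ∀ x (hx : x ∈ J), x ∈ I ^ (n + k) → g ⟨x, hx⟩ = 0 := by
    intro x hx hxI
    have key : I ^ n • J ≤ (LinearMap.ker g).map J.subtype :=
      Submodule.smul_le.2 fun a ha b hb =>
        ⟨a • ⟨b, hb⟩, by rw [SetLike.mem_coe, LinearMap.mem_ker, map_smul, hn a ha], rfl⟩
    obtain ⟨y, hy, rfl⟩ := key (hk' ⟨hxI, hx⟩)
    exact hy
  -- factor through the image of `J` in `R ⧸ I ^ (n + k)`
  let q : J →ₗ[R] (R ⧸ I ^ (n + k)) := (I ^ (n + k)).mkQ ∘ₗ J.subtype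
  have hq : LinearMap.ker q ≤ LinearMap.ker ((powTorsion I M).subtype ∘ₗ g) := by
    intro x hx
    have : (x : R) ∈ I ^ (n + k) := (Submodule.Quotient.mk_eq_zero _).1 hx
    have := hzero x x.2 this
    simp [this]
  let g' : (J ⧸ LinearMap.ker q) →ₗ[R] M := Submodule.liftQ _ _ hq
  let q' : (J ⧸ LinearMap.ker q) →ₗ[R] (R ⧸ I ^ (n + k)) := Submodule.liftQ _ q le_rfl
  have hq' : Function.Injective q' := by
    rw [← LinearMap.ker_eq_bot]; exact Submodule.ker_liftQ_eq_bot _ _ _ le_rfl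
  obtain ⟨φ, hφ⟩ := Module.Injective.out q' hq' g'
  have hφ1 : ∀ a ∈ I ^ (n + k), a • φ (Submodule.Quotient.mk 1) = 0 := by
    intro a ha
    rw [← map_smul, ← Submodule.Quotient.mk_smul, smul_eq_mul, mul_one,
      (Submodule.Quotient.mk_eq_zero _).2 ha, map_zero]
  refine ⟨LinearMap.toSpanSingleton R _ ⟨φ (Submodule.Quotient.mk 1), n + k, hφ1⟩, ?_⟩
  intro x hx
  apply Subtype.ext
  have := hφ (Submodule.Quotient.mk ⟨x, hx⟩)
  have h3 : g' (Submodule.Quotient.mk ⟨x, hx⟩) = (g ⟨x, hx⟩ : M) := rfl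
  have h4 : q' (Submodule.Quotient.mk ⟨x, hx⟩) = Submodule.Quotient.mk x := rfl
  rw [h3, h4] at this
  rw [← this, LinearMap.toSpanSingleton_apply]
  change x • φ _ = _
  rw [← map_smul, ← Submodule.Quotient.mk_smul, smul_eq_mul, mul_one]

theorem lcMap_zero_surjective {f : M →ₗ[R] N} (hM : IsPowTorsion I M)
    (hf : Function.Surjective f) : Function.Surjective (lcMap I 0 f) := by
  intro y
  obtain ⟨e, he⟩ := hf (lcEval I N y)
  obtain ⟨z, rfl⟩ := (mem_range_lcEval I e).2 (hM e)
  exact ⟨z, lcEval_injective I (by rw [lcEval_lcMap, he])⟩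

/-- An `I`-power torsion module `M` has `H^i_I(M) = 0` for `i > 0`: embed `M` in a power torsion
injective module and shift degrees. -/
theorem lc_subsingleton_of_isPowTorsion [IsNoetherianRing R] (i : ℕ) (hM : IsPowTorsion I M) :
    Subsingleton (lc I (i + 1) M) := by
  induction i using Nat.strong_induction_on generalizing M with
  | _ i ih =>
  let E := CategoryTheory.Injective.under (ModuleCat.of R M)
  let ι : M →ₗ[R] E := (CategoryTheory.Injective.ι (ModuleCat.of R M)).hom
  have hι : Function.Injective ι := (ModuleCat.mono_iff_injective _).1 inferInstance
  have : CategoryTheory.Injective (ModuleCat.of R E) :=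
    inferInstanceAs (CategoryTheory.Injective (CategoryTheory.Injective.under (ModuleCat.of R M)))
  have : Module.Injective R E := Module.injective_module_of_injective_object R E
  have : Module.Injective R (powTorsion I E) := injective_powTorsion I
  let ι' : M →ₗ[R] powTorsion I E := LinearMap.codRestrict _ ι (fun m => by
    obtain ⟨n, hn⟩ := hM m
    exact ⟨n, fun a ha => by rw [← map_smul, hn a ha, map_zero]⟩)
  have hι' : Function.Injective ι' := fun a b h => hι (congrArg Subtype.val h)
  let g := (LinearMap.range ι').mkQ
  have hg : Function.Surjective g := Submodule.mkQ_surjective _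
  have hex : Function.Exact ι' g := LinearMap.exact_map_mkQ_range ι'
  have hδ : ∀ y, lcδ I i hι' hex hg y = 0 := by
    intro y
    rcases i with - | i
    · obtain ⟨z, rfl⟩ := lcMap_zero_surjective I (isPowTorsion_powTorsion I) hg y
      exact (lc_exact₁ I 0 hι' hex hg).apply_apply_eq_zero z
    · have := ih i (by omega) ((isPowTorsion_powTorsion (M := E) I).of_surjective hg)
      rw [Subsingleton.elim y 0, map_zero]
  have := lc_subsingleton_of_injective I (M := powTorsion I E) i
  refine subsingleton_of_forall_eq 0 fun x => ?_
  obtain ⟨y, rfl⟩ := (lc_exact₃ I i hι' hex hg x).1 (Subsingleton.elim _ _)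
  exact hδ y

end Torsion

section Length
variable {R : Type u} [CommRing R] (I : Ideal R)
variable {M N E : Type u} [AddCommGroup M] [Module R M] [AddCommGroup N] [Module R N]
  [AddCommGroup E] [Module R E]

theorem length_eq_ker_add_range (f : M →ₗ[R] N) :
    Module.length R M = Module.length R (LinearMap.ker f) + Module.length R (LinearMap.range f) :=
  Module.length_eq_add_of_exact (LinearMap.ker f).subtype f.rangeRestrict
    (Submodule.injective_subtype _) (LinearMap.surjective_rangeRestrict f) (by
      rw [LinearMap.exact_iff]; simp)

/-- If the kernel of `x` on `M` is `I`-power torsion, then `M → xM` induces isomorphisms on `H^i_I`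
for `i > 0` and a surjection for `i = 0`. The long exact sequence of `0 → xM → M → M/xM → 0`
therefore splits into short exact sequences
`0 → H^i(M)/x H^i(M) → H^i(M/xM) → (0 :_{H^{i+1}(M)} x) → 0`. -/
theorem length_lc_of_exact_smul [IsNoetherianRing R] {x : R}
    (hx : IsPowTorsion I (LinearMap.ker (x • LinearMap.id : M →ₗ[R] M)))
    {g : M →ₗ[R] E} (hg : Function.Surjective g)
    (hex : Function.Exact (x • LinearMap.id : M →ₗ[R] M) g) (i : ℕ) :
    Module.length R (lc I i E) =
      Module.length R (lc I i M ⧸ LinearMap.range (x • LinearMap.id : lc I i M →ₗ[R] lc I i M)) +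
      Module.length R (LinearMap.ker (x • LinearMap.id : lc I (i + 1) M →ₗ[R] lc I (i + 1) M)) := by
  set φ : M →ₗ[R] M := x • LinearMap.id with hφ
  have hφi : ∀ i, lcMap I i φ = x • LinearMap.id := fun i => lcMap_smul_id I i x
  let p := φ.rangeRestrict
  let ι := (LinearMap.range φ).subtype
  have hp : Function.Surjective p := φ.surjective_rangeRestrict
  have hι : Function.Injective ι := Submodule.injective_subtype _
  have hφp : ∀ i, lcMap I i φ = lcMap I i ι ∘ₗ lcMap I i p := fun i => lcMap_comp I i ι p
  have ex1 : Function.Exact (LinearMap.ker φ).subtype p := by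
    rw [LinearMap.exact_iff]; simp [p]
  have ex2 : Function.Exact ι g := by
    rw [LinearMap.exact_iff] at hex ⊢; simp [ι, hex]
  have hK := Submodule.injective_subtype (LinearMap.ker φ)
  have hpsurj : ∀ i, Function.Surjective (lcMap I i p) := by
    intro i y
    have := lc_subsingleton_of_isPowTorsion I i hx
    exact (lc_exact₁ I i hK ex1 hp y).1 (Subsingleton.elim _ _)
  have hpinj : Function.Injective (lcMap I (i + 1) p) := by
    rw [injective_iff_map_eq_zero]
    intro y hy
    have := lc_subsingleton_of_isPowTorsion I i hx
    obtain ⟨z, rfl⟩ := (lc_exact₂ I (i + 1) hK ex1 hp y).1 hy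
    rw [Subsingleton.elim z 0, map_zero]
  rw [length_eq_ker_add_range (lcδ I i hι ex2 hg)]
  congr 1
  · rw [(LinearMap.exact_iff.1 (lc_exact₁ I i hι ex2 hg))]
    rw [← (LinearMap.quotKerEquivRange (lcMap I i g)).length_eq]
    have : LinearMap.ker (lcMap I i g) =
        LinearMap.range (x • LinearMap.id : lc I i M →ₗ[R] lc I i M) := by
      rw [LinearMap.exact_iff.1 (lc_exact₂ I i hι ex2 hg), ← hφi, hφp,
        LinearMap.range_comp, LinearMap.range_eq_top.2 (hpsurj i), Submodule.map_top]
    rw [this]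
  · rw [← LinearMap.exact_iff.1 (lc_exact₃ I i hι ex2 hg)]
    have h1 : LinearMap.ker (x • LinearMap.id : lc I (i + 1) M →ₗ[R] lc I (i + 1) M) =
        (LinearMap.ker (lcMap I (i + 1) ι)).comap (lcMap I (i + 1) p) := by
      rw [← hφi, hφp, LinearMap.ker_comp]
    rw [h1]
    let e := LinearEquiv.ofBijective (lcMap I (i + 1) p) ⟨hpinj, hpsurj (i + 1)⟩
    exact ((e.ofSubmodule' (LinearMap.ker (lcMap I (i + 1) ι))).length_eq).symm
end Length

/-! ### Modules of finite length over a local ring -/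

section FiniteLength
variable {R : Type u} [CommRing R] [IsLocalRing R] [IsNoetherianRing R]
variable {M N E : Type u} [AddCommGroup M] [Module R M] [AddCommGroup N] [Module R N]
  [AddCommGroup E] [Module R E]

omit [IsLocalRing R] [IsNoetherianRing R] in
theorem isFiniteLength_of_exact {f : M →ₗ[R] N} {g : N →ₗ[R] E} (hf : Function.Injective f)
    (hg : Function.Surjective g) (h : Function.Exact f g) (hM : IsFiniteLength R M)
    (hE : IsFiniteLength R E) : IsFiniteLength R N := by
  rw [← Module.length_ne_top_iff] at *
  rw [Module.length_eq_add_of_exact f g hf hg h]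
  exact WithTop.add_ne_top.2 ⟨hM, hE⟩

theorem isFiniteLength_of_support [Module.Finite R M]
    (h : ∀ p ∈ Module.support R M, p.asIdeal = maximalIdeal R) : IsFiniteLength R M := by
  revert h
  induction ‹Module.Finite R M› using
    IsNoetherianRing.induction_on_isQuotientEquivQuotientPrime R with
  | subsingleton N => exact fun _ => .of_subsingleton
  | quotient N p f =>
    intro h
    have hp : p ∈ Module.support R N := by
      rw [f.support_eq, Module.mem_support_iff_of_finite, Ideal.annihilator_quotient]
    have : p.asIdeal = maximalIdeal R := h p hp
    have hs : IsSimpleModule R (R ⧸ p.asIdeal) := by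
      rw [this]
      exact isSimpleModule_iff_isCoatom.2 (maximalIdeal.isMaximal R).out
    have h2 : IsFiniteLength R (R ⧸ p.asIdeal) := by
      rw [← Module.length_ne_top_iff, Module.length_eq_one]; simp
    exact f.symm.isFiniteLength h2
  | exact N₁ N₂ N₃ f g hf hg hfg ih₁ ih₃ =>
    intro h
    exact isFiniteLength_of_exact hf hg hfg
      (ih₁ fun p hp => h p (Module.support_subset_of_injective f hf hp))
      (ih₃ fun p hp => h p (Module.support_subset_of_surjective g hg hp))

theorem isFiniteLength_of_associatedPrimes [Module.Finite R M]
    (h : ∀ p ∈ associatedPrimes R M, p = maximalIdeal R) : IsFiniteLength R M := by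
  refine isFiniteLength_of_support fun p hp => ?_
  obtain ⟨q, hq, hqp⟩ := Ideal.exists_minimalPrimes_le (Module.annihilator_le_of_mem_support hp)
  have := h q (Module.associatedPrimes.minimalPrimes_annihilator_subset_associatedPrimes R M hq)
  exact ((maximalIdeal.isMaximal R).eq_of_le p.2.ne_top (this ▸ hqp)).symm

theorem isFiniteLength_of_pow_smul [Module.Finite R M] (n : ℕ)
    (h : ∀ a ∈ maximalIdeal R ^ n, ∀ x : M, a • x = 0) : IsFiniteLength R M := by
  refine isFiniteLength_of_support fun p hp => ?_
  have h1 : maximalIdeal R ^ n ≤ p.asIdeal :=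
    le_trans (fun a ha => Module.mem_annihilator.2 (h a ha))
      (Module.annihilator_le_of_mem_support hp)
  exact ((maximalIdeal.isMaximal R).eq_of_le p.2.ne_top (p.2.le_of_pow_le h1)).symm

omit [IsNoetherianRing R] in
/-- A module of length at most `n` is killed by `m ^ n`. -/
theorem smul_eq_zero_of_length_le (n : ℕ) (h : Module.length R M ≤ n) :
    ∀ a ∈ maximalIdeal R ^ n, ∀ x : M, a • x = 0 := by
  induction n generalizing M with
  | zero =>
    intro a _ x
    have := Module.length_eq_zero_iff.1 (nonpos_iff_eq_zero.1 (by simpa using h))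
    exact Subsingleton.elim _ _
  | succ n ih =>
    have hM : IsFiniteLength R M := Module.length_ne_top_iff.1 (ne_top_of_le_ne_top (by simp) h)
    obtain ⟨_, _⟩ := isFiniteLength_iff_isNoetherian_isArtinian.1 hM
    rcases subsingleton_or_nontrivial M with hs | hs
    · exact fun a _ x => Subsingleton.elim _ _
    have hne : maximalIdeal R • (⊤ : Submodule R M) ≠ ⊤ := fun h =>
      top_ne_bot (α := Submodule R M) <| Submodule.eq_bot_of_le_smul_of_le_jacobson_bot _ _
        (IsNoetherian.noetherian _) h.ge (IsLocalRing.maximalIdeal_le_jacobson _)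
    have hlt := Submodule.length_lt hne
    have hle : Module.length R (maximalIdeal R • (⊤ : Submodule R M) : Submodule R M) ≤ n := by
      have := hlt.trans_le h
      exact Order.le_of_lt_succ (by simpa [Order.succ_eq_add_one] using this)
    intro a ha x
    rw [pow_succ] at ha
    induction ha using Submodule.mul_induction_on' with
    | mem_mul_mem b hb c hc =>
      have := ih hle b hb ⟨c • x, Submodule.smul_mem_smul hc trivial⟩
      rw [mul_smul]
      exact congrArg Subtype.val this
    | add b _ c _ h1 h2 => rw [add_smul, h1, h2, add_zero]

omit [IsNoetherianRing R] in
theorem isPowTorsion_of_isFiniteLength (h : IsFiniteLength R M) :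
    IsPowTorsion (maximalIdeal R) M := by
  obtain ⟨n, hn⟩ := ENat.ne_top_iff_exists.1 (Module.length_ne_top_iff.2 h)
  exact fun m => ⟨n, fun a ha => smul_eq_zero_of_length_le n hn.symm.le a ha m⟩

theorem IsPowTorsion.isFiniteLength [Module.Finite R M] (h : IsPowTorsion (maximalIdeal R) M) :
    IsFiniteLength R M := by
  refine isFiniteLength_of_support fun p hp => ?_
  obtain ⟨m, hm⟩ := Module.mem_support_iff_exists_annihilator.1 hp
  obtain ⟨n, hn⟩ := h m
  have h1 : maximalIdeal R ^ n ≤ p.asIdeal := le_trans (fun a ha =>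
    (Submodule.mem_annihilator_span_singleton _ _).2 (hn a ha)) hm
  exact ((maximalIdeal.isMaximal R).eq_of_le p.2.ne_top (p.2.le_of_pow_le h1)).symm

/-- Multiplication by `y` on `M`. -/
abbrev smulMap (M : Type u) [AddCommGroup M] [Module R M] (y : R) : M →ₗ[R] M := y • LinearMap.id

variable (M) in
/-- `y` lies in no associated prime of `M` other than the maximal ideal. -/
def IsFilterRegular (y : R) : Prop :=
  ∀ p ∈ associatedPrimes R M, p ≠ maximalIdeal R → y ∉ p

theorem IsFilterRegular.isFiniteLength_ker [Module.Finite R M] {y : R} (h : IsFilterRegular M y) :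
    IsFiniteLength R (LinearMap.ker (smulMap M y)) := by
  refine isFiniteLength_of_associatedPrimes fun p hp => ?_
  by_contra hne
  refine h p (associatedPrimes.subset_of_injective (Submodule.injective_subtype _) hp) hne ?_
  exact IsAssociatedPrime.annihilator_le hp
    (Submodule.mem_annihilator.2 fun x _ => Subtype.ext x.2)

/-- Prime avoidance. -/
theorem exists_isFilterRegular (M N : Type u) [AddCommGroup M] [Module R M] [Module.Finite R M]
    [AddCommGroup N] [Module R N] [Module.Finite R N] :
    ∃ y ∈ maximalIdeal R, IsFilterRegular M y ∧ IsFilterRegular N y := by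
  by_contra! hcon
  have hfin : ((associatedPrimes R M ∪ associatedPrimes R N) \ {maximalIdeal R}).Finite :=
    ((associatedPrimes.finite R M).union (associatedPrimes.finite R N)).sdiff
  have hsub : ((maximalIdeal R : Ideal R) : Set R) ⊆
      ⋃ p ∈ ((associatedPrimes R M ∪ associatedPrimes R N) \ {maximalIdeal R}), (p : Set R) := by
    intro y hy
    have := hcon y hy
    simp only [Set.mem_iUnion]
    by_cases h : IsFilterRegular M y
    · have h2 := this h
      simp only [IsFilterRegular, not_forall, not_not] at h2
      obtain ⟨p, hp, hne, hyp⟩ := h2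
      exact ⟨p, ⟨Or.inr hp, hne⟩, hyp⟩
    · simp only [IsFilterRegular, not_forall, not_not] at h
      obtain ⟨p, hp, hne, hyp⟩ := h
      exact ⟨p, ⟨Or.inl hp, hne⟩, hyp⟩
  obtain ⟨p, ⟨hp, hne⟩, hle⟩ := (Ideal.subset_union_prime_finite hfin (f := id) ⊤ ⊤
    (fun p hp _ _ => hp.1.elim (fun h => h.isPrime) (fun h => h.isPrime))).1 hsub
  have hpp : p.IsPrime := hp.elim (fun h => h.isPrime) (fun h => h.isPrime)
  exact hne ((maximalIdeal.isMaximal R).eq_of_le hpp.ne_top hle).symm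

variable (R M) in
/-- Every prime `p` in the support of `M` has `dim R/p < t`. -/
def DimLT (t : ℕ) : Prop := ∀ p ∈ Module.support R M, ringKrullDim (R ⧸ p.asIdeal) < t

omit [IsLocalRing R] [IsNoetherianRing R] in
theorem succ_le_ringKrullDim_quotient {p q : PrimeSpectrum R} (h : q < p) (n : ℕ)
    (hn : (n : WithBot ℕ∞) ≤ ringKrullDim (R ⧸ p.asIdeal)) :
    ((n + 1 : ℕ) : WithBot ℕ∞) ≤ ringKrullDim (R ⧸ q.asIdeal) := by
  rw [ringKrullDim_quotient] at hn ⊢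
  obtain ⟨l, hl⟩ := Order.le_krullDim_iff.1 hn
  let l' : LTSeries (PrimeSpectrum.zeroLocus (q.asIdeal : Set R)) :=
    l.map (fun x => ⟨x.1, le_trans (show q.asIdeal ≤ p.asIdeal from h.le) x.2⟩) (fun _ _ h => h)
  have hlt : (⟨q, le_refl q.asIdeal⟩ : PrimeSpectrum.zeroLocus (q.asIdeal : Set R)) < l'.head :=
    (lt_of_lt_of_le h (show p ≤ l.head.1 from l.head.2) : q < l.head.1)
  refine Order.le_krullDim_iff.2 ⟨l'.cons ⟨q, le_refl q.asIdeal⟩ hlt, ?_⟩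
  rw [RelSeries.cons_length, ← hl]
  rfl

omit [IsNoetherianRing R] in
theorem eq_maximalIdeal_of_ringKrullDim_lt_one (p : PrimeSpectrum R)
    (h : ringKrullDim (R ⧸ p.asIdeal) < (1 : ℕ)) : p.asIdeal = maximalIdeal R := by
  by_contra hne
  have hlt : p < ⟨maximalIdeal R, inferInstance⟩ :=
    lt_of_le_of_ne (le_maximalIdeal p.2.ne_top) (fun h => hne (congrArg PrimeSpectrum.asIdeal h))
  refine absurd (succ_le_ringKrullDim_quotient hlt 0 ?_) (not_le.2 h)
  exact ringKrullDim_nonneg_of_nontrivial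

omit [IsNoetherianRing R] in
theorem ringKrullDim_lt_of_eq_maximalIdeal (p : PrimeSpectrum R) (h : p.asIdeal = maximalIdeal R)
    (t : ℕ) : ringKrullDim (R ⧸ p.asIdeal) < (t + 1 : ℕ) := by
  have : p.asIdeal.IsMaximal := h ▸ maximalIdeal.isMaximal R
  have h2 : ringKrullDim (R ⧸ p.asIdeal) = 0 :=
    ringKrullDim_eq_zero_of_isField (Ideal.Quotient.maximal_ideal_iff_isField_quotient _ |>.1 this)
  rw [h2]
  exact_mod_cast Nat.succ_pos t

omit [IsNoetherianRing R] in
theorem IsPowTorsion.dimLT (h : IsPowTorsion (maximalIdeal R) M) (t : ℕ) : DimLT R M (t + 1) := by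
  intro p hp
  obtain ⟨m, hm⟩ := Module.mem_support_iff_exists_annihilator.1 hp
  obtain ⟨n, hn⟩ := h m
  have h1 : maximalIdeal R ^ n ≤ p.asIdeal := le_trans (fun a ha =>
    (Submodule.mem_annihilator_span_singleton _ _).2 (hn a ha)) hm
  exact ringKrullDim_lt_of_eq_maximalIdeal p
    ((maximalIdeal.isMaximal R).eq_of_le p.2.ne_top (p.2.le_of_pow_le h1)).symm t

omit [IsLocalRing R] [IsNoetherianRing R] in
theorem exact_smulMap_mkQ (M : Type u) [AddCommGroup M] [Module R M] (y : R) :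
    Function.Exact (smulMap M y) (LinearMap.range (smulMap M y)).mkQ :=
  LinearMap.exact_map_mkQ_range _

theorem isFiniteLength_lc_of_exact {y : R} (hy : IsFiniteLength R (LinearMap.ker (smulMap M y)))
    {g : M →ₗ[R] E} (hg : Function.Surjective g) (hex : Function.Exact (smulMap M y) g) (i : ℕ)
    (h0 : IsFiniteLength R (LC R i M)) (h1 : IsFiniteLength R (LC R (i + 1) M)) :
    IsFiniteLength R (LC R i E) := by
  rw [← Module.length_ne_top_iff,
    length_lc_of_exact_smul (maximalIdeal R) (isPowTorsion_of_isFiniteLength hy) hg hex]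
  refine WithTop.add_ne_top.2 ⟨?_, ?_⟩
  · exact Module.length_ne_top_iff.2 (h0.of_surjective (Submodule.mkQ_surjective _))
  · exact Module.length_ne_top_iff.2 (h1.of_injective (Submodule.injective_subtype _))

/-- If `y` is filter-regular on `M`, then `H^0(M/y^k M)` is no longer than `H^0(M)` and `H^1(M)`
together, uniformly in `k`. If moreover `M/yM` has finite length, then `M/y^k M = H^0(M/y^k M)`, so
the lengths of the `M/y^k M` are bounded; hence `y^L M = y^{L+1} M` for some `L`, and `y^L M = 0`
by Nakayama. -/
theorem isFiniteLength_of_quotient_of_lc_one [Module.Finite R M] {y : R} (hym : y ∈ maximalIdeal R)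
    (hy : IsFilterRegular M y)
    (hq : IsFiniteLength R (M ⧸ LinearMap.range (smulMap M y)))
    (h1 : IsFiniteLength R (LC R 1 M)) : IsFiniteLength R M := by
  have h0 : IsFiniteLength R (LC R 0 M) := by
    have h2 : IsPowTorsion (maximalIdeal R) (LinearMap.range (lcEval (maximalIdeal R) M)) := by
      rintro ⟨m, hm⟩
      obtain ⟨n, hn⟩ := (mem_range_lcEval _ m).1 hm
      exact ⟨n, fun a ha => Subtype.ext (hn a ha)⟩
    exact (LinearEquiv.ofInjective _ (lcEval_injective (maximalIdeal R))).symm.isFiniteLength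
      h2.isFiniteLength
  obtain ⟨L, hL⟩ := ENat.ne_top_iff_exists.1 (WithTop.add_ne_top.2
    ⟨Module.length_ne_top_iff.2 h0, Module.length_ne_top_iff.2 h1⟩)
  have hpow : ∀ k, IsFilterRegular M (y ^ k) := fun k p hp hne hk =>
    hy p hp hne (hp.isPrime.mem_of_pow_mem k hk)
  -- `m ^ a M ≤ y M` gives `m ^ (a * k) M ≤ y ^ k M`, so every `M / y ^ k M` is torsion
  have htor : ∀ k, IsPowTorsion (maximalIdeal R) (M ⧸ LinearMap.range (smulMap M (y ^ k))) := by
    obtain ⟨a, ha⟩ := ENat.ne_top_iff_exists.1 (Module.length_ne_top_iff.2 hq)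
    have ha' := smul_eq_zero_of_length_le a ha.symm.le
    have key : ∀ k, ∀ b ∈ maximalIdeal R ^ (a * k), ∀ x : M, ∃ z : M, y ^ k • z = b • x := by
      intro k
      induction k with
      | zero => exact fun b _ x => ⟨b • x, by simp⟩
      | succ k ihk =>
        intro b hb x
        rw [mul_add, mul_one, pow_add] at hb
        induction hb using Submodule.mul_induction_on' with
        | mem_mul_mem c hc d hd =>
          obtain ⟨z, hz⟩ := (Submodule.Quotient.mk_eq_zero _).1
            (ha' d hd (Submodule.Quotient.mk x))
          obtain ⟨w, hw⟩ := ihk c hc z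
          refine ⟨w, ?_⟩
          have hz' : y • z = d • x := hz
          rw [mul_smul, ← hz', pow_succ', mul_smul, hw, smul_comm]
        | add c _ d _ h1 h2 =>
          obtain ⟨z, hz⟩ := h1
          obtain ⟨w, hw⟩ := h2
          exact ⟨z + w, by rw [smul_add, hz, hw, add_smul]⟩
    intro k x
    obtain ⟨x, rfl⟩ := Submodule.Quotient.mk_surjective _ x
    exact ⟨a * k, fun b hb => (Submodule.Quotient.mk_eq_zero _).2 (key k b hb x)⟩
  -- `M / y ^ (L + 1) M` is its own `H^0`, and `L` bounds the length of that
  have hlen : Module.length R (M ⧸ LinearMap.range (smulMap M (y ^ (L + 1)))) ≤ L := by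
    have hbij : Function.Surjective
        (lcEval (maximalIdeal R) (M ⧸ LinearMap.range (smulMap M (y ^ (L + 1))))) := fun x =>
      (mem_range_lcEval _ x).2 (htor (L + 1) x)
    rw [← (LinearEquiv.ofBijective _ ⟨lcEval_injective (maximalIdeal R), hbij⟩).length_eq,
      length_lc_of_exact_smul (maximalIdeal R)
        (isPowTorsion_of_isFiniteLength (hpow (L + 1)).isFiniteLength_ker)
        (Submodule.mkQ_surjective _) (exact_smulMap_mkQ M _) 0, hL]
    exact add_le_add (Module.length_le_of_surjective _ (Submodule.mkQ_surjective _))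
      (Module.length_le_of_injective _ (Submodule.injective_subtype _))
  have h3 := smul_eq_zero_of_length_le L hlen (y ^ L) (Ideal.pow_mem_pow hym L)
  -- `y ^ L M ≤ y ^ (L + 1) M`
  have h4 : LinearMap.range (smulMap M (y ^ L)) = ⊥ := by
    refine Submodule.eq_bot_of_le_smul_of_le_jacobson_bot (maximalIdeal R) _
      (IsNoetherian.noetherian _) ?_ (IsLocalRing.maximalIdeal_le_jacobson _)
    rintro _ ⟨x, rfl⟩
    obtain ⟨z, hz⟩ := (Submodule.Quotient.mk_eq_zero _).1 (h3 (Submodule.Quotient.mk x))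
    have : (smulMap M (y ^ L)) x = y • (smulMap M (y ^ L)) z := by
      refine Eq.trans (show smulMap M (y ^ L) x = y ^ L • x from rfl) (hz.symm.trans ?_)
      change y ^ (L + 1) • z = y • y ^ L • z
      rw [pow_succ', mul_smul]
    rw [this]
    exact Submodule.smul_mem_smul hym ⟨z, rfl⟩
  refine IsPowTorsion.isFiniteLength fun x => ?_
  obtain ⟨n, hn⟩ := htor L (Submodule.Quotient.mk x)
  refine ⟨n, fun a ha => ?_⟩
  have := (Submodule.Quotient.mk_eq_zero _).1 (hn a ha)
  rwa [h4, Submodule.mem_bot] at this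

/-- If `H^i_m(M)` has finite length for all `i < t`, then every submodule `N` of `M` whose support
has dimension less than `t` has finite length. By induction on `t`: one may take `N` maximal, so
that `M/N` has no `m`-torsion, and choose `y` filter-regular on `M` and on `M/N`. Then `N/yN`
embeds in `M/yM`, and the case `t - 1` applies to it; finally `H^1(N)` embeds in `H^1(M)` and
`isFiniteLength_of_quotient_of_lc_one` applies to `N`. -/
theorem isFiniteLength_of_dimLT [Module.Finite R M] (t : ℕ)
    (hM : ∀ i < t, IsFiniteLength R (LC R i M)) (N : Submodule R M) (hN : DimLT R N t) :
    IsFiniteLength R N := by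
  induction t generalizing M with
  | zero =>
    refine isFiniteLength_of_support fun p hp => absurd (hN p hp) (not_lt.2 ?_)
    exact ringKrullDim_nonneg_of_nontrivial
  | succ t ih =>
  rcases t with - | t
  · exact isFiniteLength_of_support fun p hp => eq_maximalIdeal_of_ringKrullDim_lt_one p (hN p hp)
  obtain ⟨P, ⟨hNP, hP⟩, hmax⟩ := set_has_maximal_iff_noetherian.2 (inferInstance : IsNoetherian R M)
    {P : Submodule R M | N ≤ P ∧ DimLT R P (t + 1 + 1)} ⟨N, le_rfl, hN⟩
  suffices hfin : IsFiniteLength R P from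
    hfin.of_injective (Submodule.inclusion_injective hNP)
  -- `M / P` has no torsion by maximality
  have htors : ∀ x : M ⧸ P, (∃ n : ℕ, ∀ a ∈ maximalIdeal R ^ n, a • x = 0) → x = 0 := by
    intro x hx
    obtain ⟨m, rfl⟩ := Submodule.Quotient.mk_surjective _ x
    let T := powTorsion (maximalIdeal R) (M ⧸ P)
    let P' := T.comap P.mkQ
    have hPP' : P ≤ P' := fun z hz => by
      have : P.mkQ z = 0 := (Submodule.Quotient.mk_eq_zero _).2 hz
      rw [Submodule.mem_comap, this]
      exact T.zero_mem
    let g : P' →ₗ[R] T := P.mkQ.restrict (fun z hz => hz)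
    have hg : Function.Surjective g := by
      rintro ⟨z, hz⟩
      obtain ⟨w, rfl⟩ := Submodule.Quotient.mk_surjective _ z
      exact ⟨⟨w, hz⟩, rfl⟩
    have hex : Function.Exact (Submodule.inclusion hPP') g := by
      rintro ⟨z, hz⟩
      constructor
      · intro h
        exact ⟨⟨z, (Submodule.Quotient.mk_eq_zero _).1 (congrArg Subtype.val h)⟩, rfl⟩
      · rintro ⟨⟨w, hw⟩, h⟩
        rw [← h]
        exact Subtype.ext ((Submodule.Quotient.mk_eq_zero _).2 hw)
    have hP' : DimLT R P' (t + 1 + 1) := by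
      intro p hp
      rw [Module.support_of_exact hex (Submodule.inclusion_injective hPP') hg] at hp
      rcases hp with hp | hp
      · exact hP p hp
      · exact (isPowTorsion_powTorsion (maximalIdeal R)).dimLT (t + 1) p hp
    have : ¬ P < P' := hmax P' ⟨hNP.trans hPP', hP'⟩
    have : P = P' := eq_of_le_of_not_lt hPP' this
    refine (Submodule.Quotient.mk_eq_zero _).2 ?_
    rw [this]
    exact hx
  obtain ⟨y, hym, hyM, hyP⟩ := exists_isFilterRegular (R := R) M (M ⧸ P)
  -- `y` is regular on `M / P`, so that `P / y P` embeds in `M / y M`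
  have hreg : ∀ x : M, y • x ∈ P → x ∈ P := by
    intro x hx
    have h1 : (Submodule.Quotient.mk x : M ⧸ P) ∈ LinearMap.ker (smulMap (M ⧸ P) y) :=
      (Submodule.Quotient.mk_eq_zero _).2 hx
    obtain ⟨n, hn⟩ := isPowTorsion_of_isFiniteLength hyP.isFiniteLength_ker ⟨_, h1⟩
    exact (Submodule.Quotient.mk_eq_zero _).1
      (htors _ ⟨n, fun a ha => congrArg Subtype.val (hn a ha)⟩)
  have hPy : IsFilterRegular P y := fun p hp =>
    hyM p (associatedPrimes.subset_of_injective (Submodule.injective_subtype _) hp)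
  have hker := hyM.isFiniteLength_ker
  let φ : P →ₗ[R] (P.map (LinearMap.range (smulMap M y)).mkQ) :=
    ((LinearMap.range (smulMap M y)).mkQ ∘ₗ P.subtype).codRestrict _
      (fun x => Submodule.mem_map_of_mem x.2)
  have hφs : Function.Surjective φ := by
    rintro ⟨_, z, hz, rfl⟩
    exact ⟨⟨z, hz⟩, rfl⟩
  have hφ : LinearMap.ker φ = LinearMap.range (smulMap P y) := by
    ext ⟨z, hz⟩
    constructor
    · intro h
      obtain ⟨w, hw⟩ := (Submodule.Quotient.mk_eq_zero _).1 (congrArg Subtype.val h)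
      have hw' : y • w = z := hw
      exact ⟨⟨w, hreg w (hw' ▸ hz)⟩, Subtype.ext hw⟩
    · rintro ⟨w, hw⟩
      rw [← hw]
      exact Subtype.ext ((Submodule.Quotient.mk_eq_zero _).2 ⟨w, rfl⟩)
  -- the support drops in dimension, `y` avoiding the minimal primes of `P` other than `m`
  have hdim : DimLT R (P.map (LinearMap.range (smulMap M y)).mkQ) (t + 1) := by
    intro p hp
    have hpP : p ∈ Module.support R P := Module.support_subset_of_surjective φ hφs hp
    have hyp : y ∈ p.asIdeal := by
      refine Module.annihilator_le_of_mem_support hp (Module.mem_annihilator.2 fun z => ?_)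
      obtain ⟨w, rfl⟩ := hφs z
      rw [← map_smul]
      change y • w ∈ LinearMap.ker φ
      rw [hφ]
      exact ⟨w, rfl⟩
    obtain ⟨q, hq, hqp⟩ := Ideal.exists_minimalPrimes_le (Module.annihilator_le_of_mem_support hpP)
    have hqa := Module.associatedPrimes.minimalPrimes_annihilator_subset_associatedPrimes R P hq
    by_cases hqm : q = maximalIdeal R
    · exact ringKrullDim_lt_of_eq_maximalIdeal p
        ((maximalIdeal.isMaximal R).eq_of_le p.2.ne_top (hqm ▸ hqp)).symm t
    · have hlt : (⟨q, hqa.isPrime⟩ : PrimeSpectrum R) < p :=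
        lt_of_le_of_ne hqp (fun h => hPy q hqa hqm (by rw [← h] at hyp; exact hyp))
      have hqs : (⟨q, hqa.isPrime⟩ : PrimeSpectrum R) ∈ Module.support R P := by
        rw [Module.support_eq_zeroLocus]; exact hq.1.2
      by_contra hcon
      exact absurd (succ_le_ringKrullDim_quotient hlt (t + 1) (not_lt.1 hcon)) (not_le.2 (hP _ hqs))
  have hq := ih (M := M ⧸ LinearMap.range (smulMap M y))
    (fun i hi => isFiniteLength_lc_of_exact hker (Submodule.mkQ_surjective _)
      (exact_smulMap_mkQ M y) i (hM i (by omega)) (hM (i + 1) (by omega)))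
    (P.map (LinearMap.range (smulMap M y)).mkQ) hdim
  refine isFiniteLength_of_quotient_of_lc_one hym hPy ?_ ?_
  · rw [← hφ]
    exact hq.of_injective (f := (LinearMap.ker φ).liftQ φ le_rfl) (by
      rw [← LinearMap.ker_eq_bot]; exact Submodule.ker_liftQ_eq_bot _ _ _ le_rfl)
  · have hex := LinearMap.exact_subtype_mkQ P
    refine (hM 1 (by omega)).of_injective (f := lcMap (maximalIdeal R) 1 P.subtype) ?_
    rw [injective_iff_map_eq_zero]
    intro z hz
    obtain ⟨w, rfl⟩ := (lc_exact₃ (maximalIdeal R) 0 (Submodule.injective_subtype P) hex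
      (Submodule.mkQ_surjective P) z).1 hz
    have : w = 0 := lcEval_injective _ (by
      rw [map_zero]; exact htors _ ((mem_range_lcEval _ _).1 ⟨w, rfl⟩))
    rw [this, map_zero]

end FiniteLength

/-! ### Local cohomology modulo one element -/

section OneElement
variable {R : Type u} [CommRing R] [IsLocalRing R] [IsNoetherianRing R]

/-- The length of `H^i_m(R/J)`. -/
def lcLength (J : Ideal R) (i : ℕ) : ℕ∞ := Module.length R (LC R i (R ⧸ J))

omit [IsLocalRing R] [IsNoetherianRing R] in
theorem exact_smulMap_factor (J : Ideal R) (x : R) :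
    Function.Exact (smulMap (R ⧸ J) x)
      (Submodule.factor (le_sup_left : J ≤ J ⊔ Ideal.span {x})) := by
  intro y
  obtain ⟨a, rfl⟩ := Submodule.Quotient.mk_surjective _ y
  constructor
  · intro h
    have h1 : a ∈ J ⊔ Ideal.span {x} := (Submodule.Quotient.mk_eq_zero _).1 h
    obtain ⟨b, hb, c, hc, rfl⟩ := Submodule.mem_sup.1 h1
    obtain ⟨e, rfl⟩ := Ideal.mem_span_singleton'.1 hc
    refine ⟨Submodule.Quotient.mk e, (Submodule.Quotient.eq _).2 ?_⟩
    have : x • e - (b + e * x) = -b := by rw [smul_eq_mul]; ring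
    exact this ▸ J.neg_mem hb
  · rintro ⟨z, hz⟩
    obtain ⟨e, rfl⟩ := Submodule.Quotient.mk_surjective _ z
    rw [← hz]
    refine (Submodule.Quotient.mk_eq_zero _).2 (Submodule.mem_sup_right ?_)
    exact Ideal.mem_span_singleton'.2 ⟨e, mul_comm _ _⟩

/-- If `R/J` has finite length local cohomology below degree `t` and `R/(J + x)` has dimension less
than `t`, then `x` is filter-regular on `R/J`: the kernel of `x` is supported on `V(J + x)`. -/
theorem isFiniteLength_ker_of_ringKrullDim_lt {J : Ideal R} {t : ℕ}
    (hJ : ∀ i < t, IsFiniteLength R (LC R i (R ⧸ J))) {x : R}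
    (hx : ringKrullDim (R ⧸ (J ⊔ Ideal.span {x})) < t) :
    IsFiniteLength R (LinearMap.ker (smulMap (R ⧸ J) x)) := by
  refine isFiniteLength_of_dimLT t hJ _ fun p hp => lt_of_le_of_lt ?_ hx
  have hJp : J ≤ p.asIdeal := by
    have := Module.annihilator_le_of_mem_support
      (Module.support_subset_of_injective _ (Submodule.injective_subtype _) hp)
    rwa [Ideal.annihilator_quotient] at this
  have hxp : x ∈ p.asIdeal := by
    refine Module.annihilator_le_of_mem_support hp (Module.mem_annihilator.2 ?_)
    exact fun z => Subtype.ext z.2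
  exact ringKrullDim_le_of_surjective (Ideal.Quotient.factor
    (sup_le hJp ((Ideal.span_singleton_le_iff_mem _).2 hxp))) (Ideal.Quotient.factor_surjective _)

theorem lcLength_sup_span {J : Ideal R} {x : R}
    (hx : IsFiniteLength R (LinearMap.ker (smulMap (R ⧸ J) x))) (i : ℕ) :
    lcLength (J ⊔ Ideal.span {x}) i =
      Module.length R (LC R i (R ⧸ J) ⧸ LinearMap.range (smulMap (LC R i (R ⧸ J)) x)) +
      Module.length R (LinearMap.ker (smulMap (LC R (i + 1) (R ⧸ J)) x)) :=
  length_lc_of_exact_smul (maximalIdeal R) (isPowTorsion_of_isFiniteLength hx)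
    (Submodule.factor_surjective _) (exact_smulMap_factor J x) i

theorem lcLength_sup_span_le {J : Ideal R} {x : R}
    (hx : IsFiniteLength R (LinearMap.ker (smulMap (R ⧸ J) x))) (i : ℕ) :
    lcLength (J ⊔ Ideal.span {x}) i ≤ lcLength J i + lcLength J (i + 1) := by
  rw [lcLength_sup_span hx]
  exact add_le_add (Module.length_le_of_surjective _ (Submodule.mkQ_surjective _))
    (Module.length_le_of_injective _ (Submodule.injective_subtype _))

omit [IsNoetherianRing R] in
theorem smulMap_eq_of_sub_mem {M : Type u} [AddCommGroup M] [Module R M] {N : ℕ}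
    (hM : Module.length R M ≤ N) {x y : R} (h : x - y ∈ maximalIdeal R ^ N) :
    smulMap M x = smulMap M y := by
  ext z
  have := smul_eq_zero_of_length_le N hM _ h z
  rw [sub_smul, sub_eq_zero] at this
  exact this

/-- The lengths of `H^i_m(R/(J + x))` only depend on the action of `x` on the modules `H^i_m(R/J)`,
and an element of `m ^ N` acts as zero on a module of length at most `N`. -/
theorem lcLength_sup_span_eq {J : Ideal R} {x y : R} {N : ℕ} (hxy : x - y ∈ maximalIdeal R ^ N)
    (hx : IsFiniteLength R (LinearMap.ker (smulMap (R ⧸ J) x)))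
    (hy : IsFiniteLength R (LinearMap.ker (smulMap (R ⧸ J) y))) (i : ℕ)
    (h0 : lcLength J i ≤ N) (h1 : lcLength J (i + 1) ≤ N) :
    lcLength (J ⊔ Ideal.span {x}) i = lcLength (J ⊔ Ideal.span {y}) i := by
  rw [lcLength_sup_span hx, lcLength_sup_span hy, smulMap_eq_of_sub_mem h0 hxy,
    smulMap_eq_of_sub_mem h1 hxy]

theorem ringKrullDim_quotient_le_add_one {J : Ideal R} {x : R} (hx : x ∈ maximalIdeal R) :
    ringKrullDim (R ⧸ J) ≤ ringKrullDim (R ⧸ (J ⊔ Ideal.span {x})) + 1 := by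
  have h := Module.supportDim_le_supportDim_quotSMulTop_succ (M := R ⧸ J) hx
  have h2 : Module.supportDim R (QuotSMulTop x (R ⧸ J)) =
      ringKrullDim (R ⧸ (J ⊔ Ideal.span {x})) := by
    rw [ringKrullDim_quotient, Module.supportDim, Module.support_quotSMulTop,
      Module.support_eq_zeroLocus, Ideal.annihilator_quotient, PrimeSpectrum.zeroLocus_sup,
      PrimeSpectrum.zeroLocus_span]
  rwa [h2, Module.supportDim_quotient_eq_ringKrullDim] at h

/-- The sum `∑_k binom(c, k) a (i + k)`, defined by the recursion of Pascal's triangle. It bounds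
the length of `H^i_m` modulo `c` elements when `a` gives the lengths of the `H^i_m(R)`. -/
def binomialSum (a : ℕ → ℕ∞) : ℕ → ℕ → ℕ∞
  | 0, i => a i
  | c + 1, i => binomialSum a c i + binomialSum a c (i + 1)

theorem binomialSum_eq_sum (a : ℕ → ℕ∞) (c i : ℕ) :
    binomialSum a c i = ∑ k ∈ Finset.range (c + 1), (c.choose k : ℕ∞) * a (i + k) := by
  induction c generalizing i with
  | zero => simp [binomialSum]
  | succ c ih =>
    rw [binomialSum, ih, ih, Finset.sum_range_succ' _ (c + 1)]
    have h1 : ∑ k ∈ Finset.range (c + 1), (c.choose k : ℕ∞) * a (i + k) =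
        ∑ k ∈ Finset.range (c + 1), (c.choose (k + 1) : ℕ∞) * a (i + (k + 1)) + a i := by
      have : ∑ k ∈ Finset.range (c + 1), (c.choose k : ℕ∞) * a (i + k) =
          ∑ k ∈ Finset.range (c + 2), (c.choose k : ℕ∞) * a (i + k) := by
        rw [Finset.sum_range_succ _ (c + 1)]; simp
      rw [this, Finset.sum_range_succ']; simp
    rw [h1]
    simp only [Nat.choose_succ_succ, Nat.cast_add, add_mul, Finset.sum_add_distrib]
    simp only [Nat.choose_zero_right, Nat.cast_one, one_mul, add_zero, Nat.succ_eq_add_one]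
    have h2 : ∀ k, i + 1 + k = i + (k + 1) := fun k => by ring
    simp only [h2]
    ring

theorem binomialSum_le (a : ℕ → ℕ∞) {c i n : ℕ} (h : c + i ≤ n) :
    binomialSum a c i ≤ binomialSum a n 0 := by
  induction i generalizing c with
  | zero =>
    induction n, h using Nat.le_induction with
    | base => exact le_rfl
    | succ n _ ih => exact ih.trans le_self_add
  | succ i ih => exact le_trans le_add_self (ih (c := c + 1) (by omega))

theorem withBot_lt_of_add_succ_le {a : WithBot ℕ∞} {k d : ℕ} (hk : k < d)
    (h : a + ((k + 1 : ℕ) : WithBot ℕ∞) ≤ d) : a < ((d - k : ℕ) : WithBot ℕ∞) := by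
  induction a with
  | bot => exact WithBot.bot_lt_coe _
  | coe a =>
    induction a using ENat.recTopCoe with
    | top => exact absurd h (by rw [not_le]; exact WithBot.coe_lt_coe.2 (ENat.natCast_lt_top d))
    | coe a =>
      have h' : a + (k + 1) ≤ d := by exact_mod_cast h
      have : a < d - k := by omega
      exact WithBot.coe_lt_coe.2 (Nat.cast_lt.2 this)

/-- For part of a system of parameters `f_j`, `j ∈ U`, in a generalized Cohen-Macaulay ring,
killing `c` of the elements leaves local cohomology of finite length in degrees `i < d - c`,
bounded by `binomialSum _ c i`. -/
theorem lcLength_span_le {ι : Type*} [DecidableEq ι] (f : ι → R) (d : ℕ) (U : Finset ι)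
    (hR : ∀ i < d, lcLength (⊥ : Ideal R) i ≠ ⊤)
    (hf : ∀ T ⊆ U, ringKrullDim (R ⧸ Ideal.span (f '' T)) + T.card ≤ d) (T : Finset ι)
    (hT : T ⊆ U) :
    ∀ i, i + T.card < d → lcLength (Ideal.span (f '' T)) i ≠ ⊤ ∧
      lcLength (Ideal.span (f '' T)) i ≤ binomialSum (lcLength (⊥ : Ideal R)) T.card i := by
  induction T using Finset.induction_on with
  | empty =>
    intro i hi
    simp only [Finset.coe_empty, Set.image_empty, Ideal.span_empty, Finset.card_empty]
    exact ⟨hR i (by simpa using hi), le_rfl⟩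
  | insert b T hb ih =>
    intro i hi
    rw [Finset.card_insert_of_notMem hb] at hi ⊢
    have hJ : Ideal.span (f '' ((insert b T : Finset ι) : Set ι)) =
        Ideal.span (f '' T) ⊔ Ideal.span {f b} := by
      rw [Finset.coe_insert, Set.image_insert_eq, Ideal.span_insert, sup_comm]
    have hT' : T ⊆ U := (Finset.subset_insert _ _).trans hT
    have hdim := hf _ hT
    rw [Finset.card_insert_of_notMem hb, hJ] at hdim
    have hker := isFiniteLength_ker_of_ringKrullDim_lt (J := Ideal.span (f '' T)) (x := f b)
      (t := d - T.card)
      (fun i hi => Module.length_ne_top_iff.1 (ih hT' i (by omega)).1) (by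
        exact withBot_lt_of_add_succ_le (by omega) hdim)
    have hle := lcLength_sup_span_le hker i
    rw [hJ]
    refine ⟨ne_top_of_le_ne_top (WithTop.add_ne_top.2
      ⟨(ih hT' i (by omega)).1, (ih hT' (i + 1) (by omega)).1⟩) hle, hle.trans ?_⟩
    exact add_le_add (ih hT' i (by omega)).2 (ih hT' (i + 1) (by omega)).2

end OneElement

/-! ### Integer sequences with eventually polynomial growth -/

section Sequences
open Filter

/-- The `s`-th forward difference of the integer sequence `h` is eventually equal to `c`. For a
sequence that is eventually polynomial of degree at most `s`, this says that `c / s!` is the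
coefficient of degree `s`; in particular `HasLead s h 0` says that `h` is eventually polynomial of
degree less than `s`. -/
def HasLead (s : ℕ) (h : ℕ → ℤ) (c : ℤ) : Prop := ∀ᶠ n in atTop, (fwdDiff 1)^[s] h n = c

theorem HasLead.congr {s : ℕ} {h h' : ℕ → ℤ} {c : ℤ} (hh : HasLead s h c)
    (e : ∀ᶠ n in atTop, h n = h' n) : HasLead s h' c := by
  obtain ⟨a, ha⟩ := eventually_atTop.1 e
  have key : ∀ k n, a ≤ n → (fwdDiff 1)^[k] h n = (fwdDiff 1)^[k] h' n := by
    intro k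
    induction k with
    | zero => exact ha
    | succ k ih =>
      intro n hn
      rw [Function.iterate_succ_apply', Function.iterate_succ_apply', fwdDiff, fwdDiff, ih n hn,
        ih (n + 1) (by omega)]
  filter_upwards [hh, eventually_ge_atTop a] with n hn hna
  rw [← key s n hna, hn]

theorem HasLead.add {s : ℕ} {h h' : ℕ → ℤ} {c c' : ℤ} (hh : HasLead s h c) (hh' : HasLead s h' c') :
    HasLead s (fun n => h n + h' n) (c + c') := by
  filter_upwards [hh, hh'] with n h1 h2
  have := fwdDiff_iter_add (1 : ℕ) h h' s
  change (fwdDiff 1)^[s] (h + h') n = _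
  rw [this, Pi.add_apply, h1, h2]

theorem HasLead.neg {s : ℕ} {h : ℕ → ℤ} {c : ℤ} (hh : HasLead s h c) :
    HasLead s (fun n => - h n) (-c) := by
  filter_upwards [hh] with n h1
  have := fwdDiff_iter_const_smul (1 : ℕ) (-1 : ℤ) h s
  have h2 : (fun n => - h n) = (-1 : ℤ) • h := by ext; simp
  rw [h2, this, Pi.smul_apply, h1]
  simp

theorem HasLead.sub {s : ℕ} {h h' : ℕ → ℤ} {c c' : ℤ} (hh : HasLead s h c) (hh' : HasLead s h' c') :
    HasLead s (fun n => h n - h' n) (c - c') := by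
  simpa [sub_eq_add_neg] using hh.add hh'.neg

theorem HasLead.sum {ι : Type*} {s : ℕ} {h : ι → ℕ → ℤ} {c : ι → ℤ} (t : Finset ι)
    (hh : ∀ i ∈ t, HasLead s (h i) (c i)) :
    HasLead s (fun n => ∑ i ∈ t, h i n) (∑ i ∈ t, c i) := by
  classical
  induction t using Finset.induction_on with
  | empty =>
    simp only [Finset.sum_empty]
    refine Eventually.of_forall fun n => ?_
    have : ∀ k, (fwdDiff 1)^[k] (fun _ : ℕ => (0 : ℤ)) = fun _ => 0 := by
      intro k
      induction k with
      | zero => rfl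
      | succ k ih => rw [Function.iterate_succ_apply', ih]; ext; simp [fwdDiff]
    rw [this]
  | insert i t hi ih =>
    simp only [Finset.sum_insert hi]
    exact (hh i (Finset.mem_insert_self _ _)).add
      (ih fun j hj => hh j (Finset.mem_insert_of_mem hj))

theorem hasLead_succ_iff {s : ℕ} {h : ℕ → ℤ} {c : ℤ} :
    HasLead (s + 1) h c ↔ HasLead s (fun n => h (n + 1) - h n) c := Iff.rfl

theorem HasLead.succ {s : ℕ} {h : ℕ → ℤ} {c : ℤ} (hh : HasLead s h c) : HasLead (s + 1) h 0 := by
  obtain ⟨a, ha⟩ := eventually_atTop.1 hh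
  refine eventually_atTop.2 ⟨a, fun n hn => ?_⟩
  rw [Function.iterate_succ_apply', fwdDiff, ha n hn, ha (n + 1) (by omega), sub_self]

theorem HasLead.mono {s t : ℕ} {h : ℕ → ℤ} (hh : HasLead s h 0) (hst : s ≤ t) : HasLead t h 0 := by
  induction t, hst using Nat.le_induction with
  | base => exact hh
  | succ t _ ih => exact ih.succ

theorem HasLead.of_lt {s t : ℕ} {h : ℕ → ℤ} {c : ℤ} (hh : HasLead s h c) (hst : s < t) :
    HasLead t h 0 := hh.succ.mono hst

theorem fwdDiff_iter_shift (h : ℕ → ℤ) (a k n : ℕ) :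
    (fwdDiff 1)^[k] (fun n => h (n + a)) n = (fwdDiff 1)^[k] h (n + a) := by
  induction k generalizing n with
  | zero => rfl
  | succ k ih =>
    rw [Function.iterate_succ_apply', Function.iterate_succ_apply', fwdDiff, fwdDiff, ih, ih,
      add_right_comm]

theorem HasLead.comp_add {s : ℕ} {h : ℕ → ℤ} {c : ℤ} (hh : HasLead s h c) (a : ℕ) :
    HasLead s (fun n => h (n + a)) c := by
  filter_upwards [(tendsto_add_atTop_nat a).eventually hh] with n hn
  rw [fwdDiff_iter_shift, hn]

theorem HasLead.of_comp_add {s : ℕ} {h : ℕ → ℤ} {c : ℤ} (a : ℕ)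
    (hh : HasLead s (fun n => h (n + a)) c) : HasLead s h c := by
  obtain ⟨b, hb⟩ := eventually_atTop.1 hh
  refine eventually_atTop.2 ⟨a + b, fun n hn => ?_⟩
  obtain ⟨m, rfl⟩ : ∃ m, n = m + a := ⟨n - a, by omega⟩
  rw [← fwdDiff_iter_shift, hb m (by omega)]

theorem hasLead_const (s : ℕ) (b : ℤ) : HasLead (s + 1) (fun _ => b) 0 :=
  HasLead.of_lt (s := 0) (c := b) (Eventually.of_forall fun _ => rfl) s.succ_pos

theorem hasLead_succ_iff_exists {s : ℕ} {h : ℕ → ℤ} :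
    HasLead (s + 1) h 0 ↔ ∃ c, HasLead s h c := by
  refine ⟨fun hh => ?_, fun ⟨c, hc⟩ => hc.succ⟩
  obtain ⟨a, ha⟩ := eventually_atTop.1 hh
  refine ⟨(fwdDiff 1)^[s] h a, eventually_atTop.2 ⟨a, fun n hn => ?_⟩⟩
  induction n, hn using Nat.le_induction with
  | base => rfl
  | succ n hn ih =>
    have := ha n hn
    rw [Function.iterate_succ_apply', fwdDiff, sub_eq_zero] at this
    rw [this, ih]

/-- An integer sequence with negative increments is eventually negative. -/
theorem eventually_neg_of_fwdDiff_iter_neg {s : ℕ} {h : ℕ → ℤ}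
    (hh : ∀ᶠ n in atTop, (fwdDiff 1)^[s] h n < 0) : ∀ᶠ n in atTop, h n < 0 := by
  induction s with
  | zero => exact hh
  | succ s ih =>
    refine ih ?_
    obtain ⟨a, ha⟩ := eventually_atTop.1 hh
    simp only [Function.iterate_succ_apply'] at ha
    set g := (fwdDiff 1)^[s] h
    have key : ∀ k : ℕ, g (a + k) ≤ g a - k := by
      intro k
      induction k with
      | zero => simp
      | succ k ih =>
        have : g (a + k + 1) - g (a + k) < 0 := ha (a + k) (by omega)
        rw [← add_assoc]
        push_cast
        omega
    refine eventually_atTop.2 ⟨a + ((g a).toNat + 1), fun n hn => ?_⟩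
    obtain ⟨k, rfl⟩ : ∃ k, n = a + k := ⟨n - a, by omega⟩
    have := key k
    have := Int.self_le_toNat (g a)
    omega

/-- Leading coefficients are monotone. -/
theorem HasLead.le {s : ℕ} {h h' : ℕ → ℤ} {c c' : ℤ} (hh : HasLead s h c) (hh' : HasLead s h' c')
    (hle : ∀ᶠ n in atTop, h n ≤ h' n) : c ≤ c' := by
  by_contra hcon
  have h1 := hh'.sub hh
  have h2 := eventually_neg_of_fwdDiff_iter_neg (s := s) (h := fun n => h' n - h n)
    (Filter.Eventually.mono h1 fun n hn => by rw [hn]; omega)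
  obtain ⟨n, hn, hn'⟩ := (hle.and h2).exists
  omega

theorem HasLead.zero (s : ℕ) : HasLead s (fun _ => 0) 0 := by
  simpa using HasLead.sum (ι := Empty) (s := s) (h := fun _ _ => 0) (c := fun _ => 0) ∅ (by simp)

theorem HasLead.nonneg {s : ℕ} {h : ℕ → ℤ} {c : ℤ} (hh : HasLead s h c)
    (hle : ∀ᶠ n in atTop, 0 ≤ h n) : 0 ≤ c := (HasLead.zero s).le hh hle

/-- A nonnegative eventually polynomial sequence dominated by a sequence of degree at most `s` has
degree at most `s`. -/
theorem exists_hasLead_of_le {s D : ℕ} {h h' : ℕ → ℤ} {c' : ℤ} (hD : HasLead D h 0)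
    (h0 : ∀ᶠ n in atTop, 0 ≤ h n) (hle : ∀ᶠ n in atTop, h n ≤ h' n) (hh' : HasLead s h' c') :
    ∃ c, HasLead s h c ∧ 0 ≤ c ∧ c ≤ c' := by
  suffices ∃ c, HasLead s h c by
    obtain ⟨c, hc⟩ := this
    exact ⟨c, hc, hc.nonneg h0, hc.le hh' hle⟩
  rw [← hasLead_succ_iff_exists]
  by_cases hDs : D ≤ s + 1
  · exact hD.mono hDs
  induction D with
  | zero => omega
  | succ D ih =>
    obtain ⟨c, hc⟩ := hasLead_succ_iff_exists.1 hD
    have : c = 0 := le_antisymm (hc.le (hh'.of_lt (by omega)) hle) (hc.nonneg h0)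
    subst this
    by_cases hDs' : D ≤ s + 1
    · exact hc.mono hDs'
    · exact ih hc hDs'

theorem HasLead.zero_of_le {s D : ℕ} {h h' : ℕ → ℤ} (hD : HasLead D h 0)
    (h0 : ∀ᶠ n in atTop, 0 ≤ h n) (hle : ∀ᶠ n in atTop, h n ≤ h' n) (hh' : HasLead s h' 0) :
    HasLead s h 0 := by
  obtain ⟨c, hc, h1, h2⟩ := exists_hasLead_of_le hD h0 hle hh'
  rwa [le_antisymm h2 h1] at hc

end Sequences

/-! ### Colengths and the Hilbert-Serre theorem -/

section Colength
variable {R : Type u} [CommRing R] {M : Type u} [AddCommGroup M] [Module R M]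

/-- The colength of a submodule, as an integer; it is meaningful for submodules of finite
colength. -/
def colength (A : Submodule R M) : ℤ := ((Module.length R (M ⧸ A)).toNat : ℤ)

theorem coe_colength {A : Submodule R M} (hA : IsFiniteLength R (M ⧸ A)) :
    (((Module.length R (M ⧸ A)).toNat : ℕ) : ℕ∞) = Module.length R (M ⧸ A) :=
  ENat.natCast_toNat (Module.length_ne_top_iff.2 hA)

theorem isFiniteLength_quotient_mono {A B : Submodule R M} (h : A ≤ B)
    (hA : IsFiniteLength R (M ⧸ A)) : IsFiniteLength R (M ⧸ B) :=
  hA.of_surjective (Submodule.factor_surjective h)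

theorem colength_anti {A B : Submodule R M} (hA : IsFiniteLength R (M ⧸ A)) (h : A ≤ B) :
    colength B ≤ colength A := by
  have h1 := Module.length_le_of_surjective (R := R) _ (Submodule.factor_surjective h)
  rw [← coe_colength hA, ← coe_colength (isFiniteLength_quotient_mono h hA)] at h1
  rw [colength, colength]
  exact_mod_cast h1

theorem length_quotient_eq_add (C A : Submodule R M) :
    Module.length R (M ⧸ C) = Module.length R (A.map C.mkQ) + Module.length R (M ⧸ (C ⊔ A)) := by
  rw [Module.length_eq_add_of_exact _ _ (Submodule.injective_subtype (A.map C.mkQ))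
    (Submodule.mkQ_surjective _) (LinearMap.exact_subtype_mkQ _),
    (Submodule.quotientQuotientEquivQuotientSup C A).length_eq]

theorem length_map_eq_of_ker_eq {E F : Type u} [AddCommGroup E] [Module R E] [AddCommGroup F]
    [Module R F] (A : Submodule R M) (φ : M →ₗ[R] E) (ψ : M →ₗ[R] F)
    (h : ∀ a ∈ A, φ a = 0 ↔ ψ a = 0) :
    Module.length R (A.map φ) = Module.length R (A.map ψ) := by
  have h1 : LinearMap.ker (φ.domRestrict A) = LinearMap.ker (ψ.domRestrict A) := by
    ext ⟨a, ha⟩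
    exact h a ha
  have h2 := (φ.domRestrict A).quotKerEquivRange.length_eq
  have h3 := (ψ.domRestrict A).quotKerEquivRange.length_eq
  rw [LinearMap.range_domRestrict] at h2 h3
  rw [← h2, ← h3, h1]

theorem isFiniteLength_quotient_inf_comap {A B : Submodule R M} (hA : IsFiniteLength R (M ⧸ A))
    (hB : IsFiniteLength R (M ⧸ B)) (φ : M →ₗ[R] M) :
    IsFiniteLength R (M ⧸ (A ⊓ B.comap φ)) := by
  have h := length_quotient_eq_add (A ⊓ B.comap φ) A
  rw [sup_eq_right.2 (inf_le_left : A ⊓ B.comap φ ≤ A)] at h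
  rw [← Module.length_ne_top_iff, h]
  refine WithTop.add_ne_top.2 ⟨?_, Module.length_ne_top_iff.2 hA⟩
  rw [length_map_eq_of_ker_eq A _ (B.mkQ ∘ₗ φ)]
  · exact ne_top_of_le_ne_top (Module.length_ne_top_iff.2 hB)
      (Module.length_le_of_injective _ (Submodule.injective_subtype _))
  · intro a ha
    simp [ha]

/-- The map `φ` induces an isomorphism from `A / (A ∩ φ⁻¹ B)` onto `(B + φ A) / B`. -/
theorem colength_sub_colength_sup_map {A B : Submodule R M} (hA : IsFiniteLength R (M ⧸ A))
    (hB : IsFiniteLength R (M ⧸ B)) (φ : M →ₗ[R] M) :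
    colength B - colength (B ⊔ A.map φ) = colength (A ⊓ B.comap φ) - colength A := by
  have hC := isFiniteLength_quotient_inf_comap hA hB φ
  have h := length_quotient_eq_add (A ⊓ B.comap φ) A
  rw [sup_eq_right.2 (inf_le_left : A ⊓ B.comap φ ≤ A)] at h
  have h2 := length_quotient_eq_add B (A.map φ)
  have h3 : Module.length R (A.map (A ⊓ B.comap φ).mkQ) =
      Module.length R ((A.map φ).map B.mkQ) := by
    rw [← Submodule.map_comp]
    refine length_map_eq_of_ker_eq A _ _ fun a ha => ?_
    simp [ha]
  have hfin : Module.length R ((A.map φ).map B.mkQ) ≠ ⊤ :=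
    ne_top_of_le_ne_top (Module.length_ne_top_iff.2 hB)
      (Module.length_le_of_injective _ (Submodule.injective_subtype _))
  obtain ⟨l, hl⟩ := ENat.ne_top_iff_exists.1 hfin
  rw [h3, ← hl, ← coe_colength hC, ← coe_colength hA] at h
  rw [← hl, ← coe_colength hB,
    ← coe_colength (isFiniteLength_quotient_mono le_sup_left hB)] at h2
  simp only [colength]
  norm_cast at h h2
  omega

theorem colength_inf_add_sup {A B : Submodule R M} (hA : IsFiniteLength R (M ⧸ A))
    (hB : IsFiniteLength R (M ⧸ B)) :
    colength (A ⊓ B) + colength (A ⊔ B) = colength A + colength B := by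
  have := colength_sub_colength_sup_map hA hB LinearMap.id
  rw [Submodule.map_id, Submodule.comap_id, sup_comm] at this
  linarith

/-- `X / Y` surjects onto `(X + Z) / (Y + Z)`. -/
theorem colength_sup_sub_le {X Y : Submodule R M} (hXY : Y ≤ X) (hY : IsFiniteLength R (M ⧸ Y))
    (Z : Submodule R M) :
    colength (Y ⊔ Z) - colength (X ⊔ Z) ≤ colength Y - colength X := by
  have h1 := colength_inf_add_sup (isFiniteLength_quotient_mono hXY hY)
    (isFiniteLength_quotient_mono (le_sup_left : Y ≤ Y ⊔ Z) hY)
  rw [← sup_assoc, sup_eq_left.2 hXY] at h1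
  have h2 := colength_anti hY (le_inf hXY (le_sup_left : Y ≤ Y ⊔ Z))
  linarith

/-- `(A + C) / A` is a quotient of `(J + C) / J`. -/
theorem colength_le_colength_sup_add {J A C : Submodule R M} (hJA : J ≤ A)
    (hA : IsFiniteLength R (M ⧸ A)) {l : ℕ} (hC : Module.length R (C.map J.mkQ) ≤ l) :
    colength A ≤ colength (A ⊔ C) + l := by
  have h := length_quotient_eq_add A C
  have h2 : Module.length R (C.map A.mkQ) ≤ l := by
    refine le_trans ?_ hC
    have h3 : C.map A.mkQ = (C.map J.mkQ).map (Submodule.factor hJA) := by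
      rw [← Submodule.map_comp]
      rfl
    rw [h3]
    exact Module.length_le_of_surjective _
      (LinearMap.submoduleMap_surjective (Submodule.factor hJA) (C.map J.mkQ))
  obtain ⟨k, hk⟩ := ENat.ne_top_iff_exists.1 (ne_top_of_le_ne_top (by simp) h2)
  rw [← hk, ← coe_colength hA,
    ← coe_colength (isFiniteLength_quotient_mono le_sup_left hA)] at h
  rw [← hk] at h2
  simp only [colength]
  norm_cast at h h2 ⊢
  omega

theorem colength_map_mkQ {J A : Submodule R M} (h : J ≤ A) :
    colength (A.map J.mkQ) = colength A := by
  rw [colength, colength, (Submodule.quotientQuotientEquivQuotient J A h).length_eq]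

theorem isFiniteLength_quotient_map_mkQ {J A : Submodule R M} (h : J ≤ A)
    (hA : IsFiniteLength R (M ⧸ A)) : IsFiniteLength R ((M ⧸ J) ⧸ A.map J.mkQ) :=
  (Submodule.quotientQuotientEquivQuotient J A h).symm.isFiniteLength hA

end Colength

section HilbertSerre
variable {R : Type u} [CommRing R] [IsNoetherianRing R] {M : Type u} [AddCommGroup M] [Module R M]
  [Module.Finite R M]

/-- A Hilbert-Serre theorem: if `A` is an `m`-stable filtration with `A (n + 1) ≤ B n ≤ A n` and
`m B n ≤ B (n + 1)`, then the length of `A n / B n` is eventually polynomial. For this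
`⨁ A n / B n` is read as a graded module over `gr_m R`; to make the induction on the number of
generators of `m` possible within filtrations of `M`, the ideal `z` collects the generators already
acting as zero. Multiplication by a further generator `x` has kernel
`(A n ∩ (B (n + 1) : x)) / B n` and cokernel `A (n + 1) / (B (n + 1) + x A n)`, which are again of
this form, the filtration in the kernel being stable by Artin-Rees. -/
theorem exists_hasLead_colength (m : Ideal R) (T : Finset R) :
    ∀ (z : Ideal R), m = Ideal.span (T : Set R) ⊔ z → ∀ A B : ℕ → Submodule R M,
      (∀ n, IsFiniteLength R (M ⧸ B n)) → (∀ n, A (n + 1) ≤ B n) → (∀ n, B n ≤ A n) →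
      (∀ n, m • A n ≤ A (n + 1)) → (∃ n₀, ∀ n ≥ n₀, A (n + 1) ≤ m • A n) →
      (∀ n, m • B n ≤ B (n + 1)) → (∀ n, z • A n ≤ B (n + 1)) →
      ∃ D, HasLead D (fun n => colength (B n) - colength (A n)) 0 := by
  classical
  induction T using Finset.induction_on with
  | empty =>
    rintro z hz A B hfin hAB hBA - ⟨n₀, hn₀⟩ - hzA
    have hmz : m = z := by simpa using hz
    subst hmz
    refine ⟨0, Filter.eventually_atTop.2 ⟨n₀ + 1, fun n hn => ?_⟩⟩
    obtain ⟨k, rfl⟩ : ∃ k, n = k + 1 := ⟨n - 1, by omega⟩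
    have : A (k + 1) = B (k + 1) := le_antisymm ((hn₀ k (by omega)).trans (hzA k)) (hBA _)
    simp [this]
  | insert x T hx ih =>
    intro z hz A B hfin hAB hBA hmA hn₀ hmB hzA
    have hz' : m = Ideal.span (T : Set R) ⊔ (z ⊔ Ideal.span {x}) := by
      rw [hz, Finset.coe_insert, Ideal.span_insert]
      ac_rfl
    have hxm : x ∈ m := hz' ▸ Submodule.mem_sup_right
      (Submodule.mem_sup_right (Ideal.mem_span_singleton_self x))
    have hfinA : ∀ n, IsFiniteLength R (M ⧸ A n) := fun n =>
      isFiniteLength_quotient_mono (hBA n) (hfin n)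
    have hAmono : ∀ n, A (n + 1) ≤ A n := fun n => (hAB n).trans (hBA n)
    have hBmono : ∀ n, B (n + 1) ≤ B n := fun n => (hBA _).trans (hAB n)
    let φ : M →ₗ[R] M := smulMap M x
    have hspan : ∀ C E : Submodule R M, C.map φ ≤ E → Ideal.span {x} • C ≤ E := by
      refine fun C E h => Submodule.smul_le.2 fun r hr a ha => ?_
      obtain ⟨c, rfl⟩ := Ideal.mem_span_singleton'.1 hr
      rw [mul_smul]
      exact E.smul_mem c (h (Submodule.mem_map_of_mem ha))
    have hxA : ∀ C : Submodule R M, C.map φ ≤ m • C := by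
      rintro C _ ⟨c, hc, rfl⟩
      exact Submodule.smul_mem_smul hxm hc
    -- the kernel of multiplication by `x`
    have hker : ∃ D, HasLead D
        (fun n => colength (B n) - colength (A n ⊓ (B (n + 1)).comap φ)) 0 := by
      have hmA' : ∀ n, m • (A n ⊓ (B (n + 1)).comap φ) ≤
          A (n + 1) ⊓ (B (n + 1 + 1)).comap φ := by
        refine fun n => Submodule.smul_le.2 fun r hr a ha =>
          ⟨hmA n (Submodule.smul_mem_smul hr ha.1), ?_⟩
        rw [SetLike.mem_coe, Submodule.mem_comap, map_smul]
        exact hmB (n + 1) (Submodule.smul_mem_smul hr ha.2)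
      refine ih (z ⊔ Ideal.span {x}) hz' (fun n => A n ⊓ (B (n + 1)).comap φ) B hfin
        (fun n => inf_le_left.trans (hAB n)) (fun n => le_inf (hBA n) ?_) hmA' ?_ hmB ?_
      · rw [← Submodule.map_le_iff_le_comap]
        exact (hxA _).trans (hmB n)
      · let F : m.Filtration M := ⟨A, hAmono, hmA⟩
        let F' : m.Filtration M := ⟨fun n => A n ⊓ (B (n + 1)).comap φ,
          fun n => inf_le_inf (hAmono n) (Submodule.comap_mono (hBmono _)), hmA'⟩
        have hF : F.Stable := by
          obtain ⟨n₀, h⟩ := hn₀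
          exact ⟨n₀, fun n hn => le_antisymm (hmA n) (h n hn)⟩
        obtain ⟨n₁, h₁⟩ := hF.of_le (F' := F') (fun n => inf_le_left)
        exact ⟨n₁, fun n hn => (h₁ n hn).ge⟩
      · intro n
        rw [Submodule.sup_smul]
        refine sup_le ((smul_mono_right _ inf_le_left).trans (hzA n)) (hspan _ _ ?_)
        rw [Submodule.map_le_iff_le_comap]
        exact inf_le_right
    -- the cokernel of multiplication by `x`
    have hcoker : ∃ D, HasLead D
        (fun n => colength (B (n + 1) ⊔ (A n).map φ) - colength (A (n + 1))) 0 := by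
      refine ih (z ⊔ Ideal.span {x}) hz' (fun n => A (n + 1)) (fun n => B (n + 1) ⊔ (A n).map φ)
        (fun n => isFiniteLength_quotient_mono le_sup_left (hfin _))
        (fun n => (hAB _).trans le_sup_left)
        (fun n => sup_le (hBA _) ((hxA _).trans (hmA n))) (fun n => hmA _) ?_ ?_ ?_
      · obtain ⟨n₀, h⟩ := hn₀
        exact ⟨n₀, fun n hn => h _ (by omega)⟩
      · intro n
        rw [Submodule.smul_sup]
        refine sup_le_sup (hmB _) (Submodule.smul_le.2 ?_)
        rintro r hr _ ⟨a, ha, rfl⟩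
        rw [← map_smul]
        exact Submodule.mem_map_of_mem (hmA n (Submodule.smul_mem_smul hr ha))
      · intro n
        rw [Submodule.sup_smul]
        exact sup_le ((hzA _).trans le_sup_left) (hspan _ _ le_sup_right)
    obtain ⟨D₁, h₁⟩ := hker
    obtain ⟨D₂, h₂⟩ := hcoker
    refine ⟨max D₁ D₂ + 1, hasLead_succ_iff.2 ?_⟩
    have := (h₂.mono (le_max_right D₁ D₂)).sub (h₁.mono (le_max_left D₁ D₂))
    rw [sub_zero] at this
    refine this.congr (Filter.Eventually.of_forall fun n => ?_)
    have := colength_sub_colength_sup_map (hfinA n) (hfin (n + 1)) φ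
    linarith

end HilbertSerre

/-! ### Hilbert-Samuel functions and dimension -/

section HilbertIdeal
variable {R : Type u} [CommRing R] [IsLocalRing R] [IsNoetherianRing R]

/-- The increment of `h` over `a` steps has `a` times the leading coefficient of that over one
step. -/
theorem HasLead.sub_comp_add {s : ℕ} {h : ℕ → ℤ} {c : ℤ}
    (hh : HasLead s (fun n => h (n + 1) - h n) c) (a : ℕ) :
    HasLead s (fun n => h (n + a) - h n) (a * c) := by
  have := HasLead.sum (Finset.range a) (h := fun j n => h (n + j + 1) - h (n + j)) (c := fun _ => c)
    (fun j _ => hh.comp_add j)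
  rw [Finset.sum_const, Finset.card_range, nsmul_eq_mul] at this
  refine this.congr (Filter.Eventually.of_forall fun n => ?_)
  exact Finset.sum_range_sub (fun j => h (n + j)) a

/-- The ideal `J + f m ^ n + m ^ (n + a)`. -/
def mixedPow (J : Ideal R) (f : R) (a n : ℕ) : Ideal R :=
  J ⊔ Ideal.span {f} * maximalIdeal R ^ n ⊔ maximalIdeal R ^ (n + a)

omit [IsNoetherianRing R] in
theorem le_mixedPow (J : Ideal R) (f : R) (a n : ℕ) : J ≤ mixedPow J f a n :=
  le_sup_left.trans le_sup_left

theorem isFiniteLength_of_pow_le {A : Ideal R} {n : ℕ} (h : maximalIdeal R ^ n ≤ A) :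
    IsFiniteLength R (R ⧸ A) := by
  refine isFiniteLength_of_pow_smul n fun a ha x => ?_
  obtain ⟨y, rfl⟩ := Submodule.Quotient.mk_surjective _ x
  exact (Submodule.Quotient.mk_eq_zero _).2 (A.mul_mem_right y (h ha))

theorem isFiniteLength_mixedPow (J : Ideal R) (f : R) (a n : ℕ) :
    IsFiniteLength R (R ⧸ mixedPow J f a n) := isFiniteLength_of_pow_le le_sup_right

/-- The Hilbert-Samuel function of `R/J`, with the index shifted: `n ↦ ℓ(R / (J + m ^ n))`. -/
def samuel (J : Ideal R) (n : ℕ) : ℤ := colength (J ⊔ maximalIdeal R ^ n)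

theorem isFiniteLength_sup_pow (J : Ideal R) (n : ℕ) :
    IsFiniteLength R (R ⧸ (J ⊔ maximalIdeal R ^ n)) := isFiniteLength_of_pow_le le_sup_right

omit [IsNoetherianRing R] in
theorem mixedPow_zero_right (J : Ideal R) (f : R) (n : ℕ) :
    mixedPow J f 0 n = J ⊔ maximalIdeal R ^ n := by
  rw [mixedPow, add_zero, sup_assoc, sup_eq_right.2 (Ideal.mul_le_right : _ ≤ maximalIdeal R ^ n)]

omit [IsNoetherianRing R] in
theorem mixedPow_one {J : Ideal R} {f : R} (hf : f ∈ maximalIdeal R) (n : ℕ) :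
    mixedPow J f 1 n = J ⊔ maximalIdeal R ^ (n + 1) := by
  have h : Ideal.span {f} * maximalIdeal R ^ n ≤ maximalIdeal R ^ (n + 1) := by
    rw [pow_succ']
    exact Ideal.mul_mono_left ((Ideal.span_singleton_le_iff_mem _).2 hf)
  rw [mixedPow, sup_assoc, sup_eq_right.2 h]

theorem exists_hasLead_mixedPow (J : Ideal R) {f : R} (hf : f ∈ maximalIdeal R) (a : ℕ) :
    ∃ D, HasLead D
      (fun n => colength (mixedPow J f (a + 1) n) - colength (mixedPow J f a n)) 0 := by
  obtain ⟨T, hT⟩ := IsNoetherian.noetherian (maximalIdeal R)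
  have hfm : Ideal.span {f} ≤ maximalIdeal R := (Ideal.span_singleton_le_iff_mem _).2 hf
  have hmul : ∀ a n, J ⊔ maximalIdeal R * mixedPow J f a n = mixedPow J f a (n + 1) := by
    intro a n
    rw [mixedPow, mixedPow, Ideal.mul_sup, Ideal.mul_sup, mul_left_comm, ← pow_succ', ← pow_succ',
      ← sup_assoc, ← sup_assoc, sup_eq_left.2 (Ideal.mul_le_right : maximalIdeal R * J ≤ J),
      add_right_comm]
  have hJ := le_mixedPow J f
  have hle : ∀ b n, maximalIdeal R • Submodule.map J.mkQ (mixedPow J f b n) ≤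
      Submodule.map J.mkQ (mixedPow J f b (n + 1)) := by
    intro b n
    rw [← Submodule.map_smul'', ← hmul]
    exact Submodule.map_mono le_sup_right
  have hAB : ∀ n, mixedPow J f a (n + 1) ≤ mixedPow J f (a + 1) n := fun n =>
    sup_le_sup (sup_le_sup le_rfl (Ideal.mul_mono_right (Ideal.pow_le_pow_right (by omega))))
      (Ideal.pow_le_pow_right (by omega))
  have hBA : ∀ n, mixedPow J f (a + 1) n ≤ mixedPow J f a n := fun n =>
    sup_le_sup le_rfl (Ideal.pow_le_pow_right (by omega))
  have hst : ∀ n, Submodule.map J.mkQ (mixedPow J f a (n + 1)) ≤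
      maximalIdeal R • Submodule.map J.mkQ (mixedPow J f a n) := by
    intro n
    rw [← hmul, Submodule.map_sup, ← Submodule.map_smul'']
    refine sup_le ?_ le_rfl
    rw [Submodule.map_le_iff_le_comap]
    intro z hz
    have : J.mkQ z = 0 := (Submodule.Quotient.mk_eq_zero _).2 hz
    rw [Submodule.mem_comap, this]
    exact zero_mem _
  obtain ⟨D, hD⟩ := exists_hasLead_colength (maximalIdeal R) T ⊥ (by rw [sup_bot_eq]; exact hT.symm)
    (fun n => Submodule.map J.mkQ (mixedPow J f a n))
    (fun n => Submodule.map J.mkQ (mixedPow J f (a + 1) n))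
    (fun n => isFiniteLength_quotient_map_mkQ (hJ _ _) (isFiniteLength_mixedPow _ _ _ _))
    (fun n => Submodule.map_mono (hAB n)) (fun n => Submodule.map_mono (hBA n)) (hle a)
    ⟨0, fun n _ => hst n⟩ (hle _) (fun n => by rw [Submodule.bot_smul]; exact bot_le)
  refine ⟨D, hD.congr (Filter.Eventually.of_forall fun n => ?_)⟩
  rw [colength_map_mkQ (hJ _ _), colength_map_mkQ (hJ _ _)]

theorem exists_hasLead_samuel (J : Ideal R) : ∃ D, HasLead D (samuel J) 0 := by
  -- for `f = 0` and `a = 0` the lengths in question are the increments of the Samuel function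
  obtain ⟨D, hD⟩ := exists_hasLead_mixedPow J (zero_mem (maximalIdeal R)) 0
  refine ⟨D + 1, hasLead_succ_iff.2 (hD.congr (Filter.Eventually.of_forall fun n => ?_))⟩
  rw [zero_add, mixedPow_one (zero_mem _), mixedPow_zero_right]
  rfl

omit [IsLocalRing R] [IsNoetherianRing R] in
theorem colength_top : colength (⊤ : Ideal R) = 0 := by
  have : Module.length R (R ⧸ (⊤ : Ideal R)) = 0 := Module.length_eq_zero_iff.2
    (Ideal.Quotient.subsingleton_iff.2 rfl)
  rw [colength, this]; rfl

omit [IsNoetherianRing R] in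
theorem samuel_nonneg (J : Ideal R) (n : ℕ) : 0 ≤ samuel J n := Int.natCast_nonneg _

theorem samuel_mono (J : Ideal R) {n k : ℕ} (h : n ≤ k) : samuel J n ≤ samuel J k :=
  colength_anti (isFiniteLength_sup_pow _ _) (sup_le_sup le_rfl (Ideal.pow_le_pow_right h))

theorem samuel_anti {J J' : Ideal R} (h : J ≤ J') (n : ℕ) : samuel J' n ≤ samuel J n :=
  colength_anti (isFiniteLength_sup_pow _ _) (sup_le_sup h le_rfl)

omit [IsLocalRing R] [IsNoetherianRing R] in
theorem map_smulMap (f : R) (A : Ideal R) : Submodule.map (smulMap R f) A = Ideal.span {f} * A := by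
  ext z
  rw [Submodule.mem_map, Ideal.mem_span_singleton_mul]
  rfl

omit [IsNoetherianRing R] in
theorem sup_pow_sup_map (J : Ideal R) (f : R) (a n : ℕ) :
    J ⊔ maximalIdeal R ^ (n + a) ⊔ Submodule.map (smulMap R f) (J ⊔ maximalIdeal R ^ n) =
      mixedPow J f a n := by
  rw [map_smulMap, Ideal.mul_sup, mixedPow]
  refine le_antisymm (sup_le (sup_le ?_ le_sup_right) (sup_le ?_ ?_)) (sup_le (sup_le ?_ ?_) ?_)
  · exact le_sup_left.trans le_sup_left
  · exact (Ideal.mul_le_right : _ ≤ J).trans (le_sup_left.trans le_sup_left)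
  · exact le_sup_right.trans le_sup_left
  · exact le_sup_left.trans le_sup_left
  · exact le_sup_right.trans le_sup_right
  · exact le_sup_right.trans le_sup_left

omit [IsNoetherianRing R] in
theorem sup_pow_sup_map_top (J : Ideal R) (f : R) (n : ℕ) :
    J ⊔ maximalIdeal R ^ n ⊔ Submodule.map (smulMap R f) (⊤ : Ideal R) =
      J ⊔ Ideal.span {f} ⊔ maximalIdeal R ^ n := by
  rw [map_smulMap, Ideal.mul_top, sup_right_comm]

theorem isFiniteLength_top : IsFiniteLength R (R ⧸ (⊤ : Ideal R)) :=
  isFiniteLength_of_pow_le (n := 0) le_top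

theorem colength_mixedPow_sub (J : Ideal R) (f : R) (a n : ℕ) :
    colength (mixedPow J f a n) - samuel J n = samuel J (n + a) -
      colength ((J ⊔ maximalIdeal R ^ n) ⊓
        Submodule.comap (smulMap R f) (J ⊔ maximalIdeal R ^ (n + a))) := by
  have h := colength_sub_colength_sup_map (isFiniteLength_sup_pow J n)
    (isFiniteLength_sup_pow J (n + a)) (smulMap R f)
  rw [sup_pow_sup_map] at h
  simp only [samuel]
  linarith

theorem samuel_sup_span (J : Ideal R) (f : R) (n : ℕ) :
    samuel (J ⊔ Ideal.span {f}) n = samuel J n -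
      colength (Submodule.comap (smulMap R f) (J ⊔ maximalIdeal R ^ n)) := by
  have h := colength_sub_colength_sup_map isFiniteLength_top
    (isFiniteLength_sup_pow J n) (smulMap R f)
  rw [sup_pow_sup_map_top, colength_top, top_inf_eq] at h
  simp only [samuel]
  linarith

/-- The kernel of `f` on `m ^ n (R/J) / m ^ (n + a) (R/J)` is contained in its kernel on
`(R/J) / m ^ (n + a) (R/J)`; for endomorphisms of modules of finite length, kernels and cokernels
have the same length. -/
theorem colength_mixedPow_sub_le (J : Ideal R) (f : R) (a n : ℕ) :
    colength (mixedPow J f a n) - samuel J n ≤ samuel (J ⊔ Ideal.span {f}) (n + a) := by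
  rw [colength_mixedPow_sub, samuel_sup_span]
  refine sub_le_sub_left (colength_anti ?_ inf_le_right) _
  exact isFiniteLength_quotient_inf_comap (isFiniteLength_sup_pow J n)
    (isFiniteLength_sup_pow J (n + a)) _

/-- Passing from `R/J` to `R/(J + x)` lowers the degree of the Hilbert-Samuel function by at most
one. -/
theorem exists_hasLead_samuel_of_sup_span {J : Ideal R} {x : R} (hx : x ∈ maximalIdeal R) {s : ℕ}
    {c : ℤ} (h : HasLead s (samuel (J ⊔ Ideal.span {x})) c) :
    ∃ c', HasLead (s + 1) (samuel J) c' ∧ 0 ≤ c' ∧ c' ≤ c := by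
  obtain ⟨D, hD⟩ := exists_hasLead_samuel J
  refine exists_hasLead_of_le (D := D) (h := fun n => samuel J (n + 1) - samuel J n)
    (hasLead_succ_iff.1 hD.succ) (Filter.Eventually.of_forall fun n => ?_)
    (Filter.Eventually.of_forall fun n => ?_) (h.comp_add 1)
  · exact sub_nonneg.2 (samuel_mono J (by omega))
  · have := colength_mixedPow_sub_le J x 1 n
    rwa [mixedPow_one hx] at this

theorem hasLead_samuel_of_pow_le {s : ℕ} (g : Fin s → R) (hg : ∀ i, g i ∈ maximalIdeal R) {k : ℕ} :
    ∀ {J : Ideal R}, maximalIdeal R ^ k ≤ J ⊔ Ideal.span (Set.range g) →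
      HasLead (s + 1) (samuel J) 0 := by
  induction s with
  | zero =>
    intro J h
    have hk : maximalIdeal R ^ k ≤ J := by simpa [Set.range_eq_empty] using h
    refine (hasLead_const 0 (colength J)).congr (Filter.eventually_atTop.2 ⟨k, fun n hn => ?_⟩)
    rw [samuel, sup_eq_left.2 ((Ideal.pow_le_pow_right hn).trans hk)]
  | succ s ih =>
    intro J h
    have h2 := ih (Fin.tail g) (fun i => hg _) (J := J ⊔ Ideal.span {g 0}) (by
      rw [← Fin.cons_self_tail g, Fin.range_cons, Ideal.span_insert, ← sup_assoc] at h
      simpa using h)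
    obtain ⟨c, hc, h0, h1⟩ := exists_hasLead_samuel_of_sup_span (hg 0) h2
    rwa [le_antisymm h1 h0] at hc

/-- Artin-Rees for colon ideals: `((J + m ^ (n + k)) : x) ⊆ (J : x) + m ^ n` for all `n`. -/
theorem exists_comap_sup_pow_le (J : Ideal R) (x : R) : ∃ k, ∀ n,
    Submodule.comap (smulMap R x) (J ⊔ maximalIdeal R ^ (n + k)) ≤
      Submodule.comap (smulMap R x) J ⊔ maximalIdeal R ^ n := by
  obtain ⟨k, hk⟩ := Ideal.exists_pow_inf_eq_pow_smul (maximalIdeal R)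
    (LinearMap.range (smulMap (R ⧸ J) x))
  refine ⟨k, fun n y hy => ?_⟩
  have hy' : x * y ∈ J ⊔ maximalIdeal R ^ (n + k) := hy
  have h1 : (Submodule.Quotient.mk (x * y) : R ⧸ J) ∈
      maximalIdeal R ^ (n + k) • (⊤ : Submodule R (R ⧸ J)) ⊓
        LinearMap.range (smulMap (R ⧸ J) x) := by
    refine ⟨?_, Submodule.Quotient.mk y, rfl⟩
    obtain ⟨a, ha, b, hb, hab⟩ := Submodule.mem_sup.1 hy'
    have h2 : (Submodule.Quotient.mk (x * y) : R ⧸ J) = b • Submodule.Quotient.mk 1 := by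
      rw [← Submodule.Quotient.mk_smul, Submodule.Quotient.eq, ← hab]
      simpa using ha
    rw [h2]
    exact Submodule.smul_mem_smul hb trivial
  rw [hk _ (by omega), Nat.add_sub_cancel] at h1
  have h3 : maximalIdeal R ^ n • (maximalIdeal R ^ k • (⊤ : Submodule R (R ⧸ J)) ⊓
      LinearMap.range (smulMap (R ⧸ J) x)) ≤
      Submodule.map (smulMap (R ⧸ J) x) (Submodule.map J.mkQ (maximalIdeal R ^ n)) := by
    refine Submodule.smul_le.2 ?_
    rintro r hr _ ⟨-, z, rfl⟩
    obtain ⟨w, rfl⟩ := Submodule.Quotient.mk_surjective _ z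
    refine ⟨Submodule.Quotient.mk (r * w), ⟨_, Ideal.mul_mem_right w _ hr, rfl⟩, ?_⟩
    rw [← map_smul]
    rfl
  obtain ⟨_, ⟨z, hz, rfl⟩, hzy⟩ := h3 h1
  have h4 : x * z - x * y ∈ J := (Submodule.Quotient.eq J).1 hzy
  rw [show y = (y - z) + z by ring]
  refine Submodule.add_mem_sup ?_ hz
  change x * (y - z) ∈ J
  rw [show x * (y - z) = -(x * z - x * y) by ring]
  exact J.neg_mem h4

omit [IsLocalRing R] [IsNoetherianRing R] in
theorem exists_prime_lt_of_succ_le {J : Ideal R} {n : ℕ}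
    (h : ((n + 1 : ℕ) : WithBot ℕ∞) ≤ ringKrullDim (R ⧸ J)) :
    ∃ p q : PrimeSpectrum R, J ≤ p.asIdeal ∧ p < q ∧
      (n : WithBot ℕ∞) ≤ ringKrullDim (R ⧸ q.asIdeal) := by
  rw [ringKrullDim_quotient] at h
  obtain ⟨⟨len, l, hl⟩, hlen⟩ := Order.le_krullDim_iff.1 h
  dsimp at hlen
  subst hlen
  have hmono : StrictMono l := Fin.strictMono_iff_lt_succ.2 hl
  refine ⟨(l 0).1, (l 1).1, (l 0).2, hmono (by simp), ?_⟩
  rw [ringKrullDim_quotient]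
  refine Order.le_krullDim_iff.2 ⟨⟨n, fun i => ⟨(l i.succ).1, ?_⟩, fun i => ?_⟩, rfl⟩
  · have h1 : l 1 ≤ l i.succ := hmono.monotone (by
      rw [← Fin.succ_zero_eq_one]; exact Fin.succ_le_succ_iff.2 (Fin.zero_le _))
    exact h1
  · exact hl i.succ

/-- If the Hilbert-Samuel function of `R/J` has degree less than `t`, then `dim R/J < t`. Given a
chain of primes `p < q < ⋯`, one passes to `R/(p + x)` with `x ∈ q \ p`; as `x` is regular on
`R/p`, this lowers the degree. -/
theorem ringKrullDim_lt_of_hasLead {t : ℕ} :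
    ∀ {J : Ideal R}, HasLead t (samuel J) 0 → ringKrullDim (R ⧸ J) < t := by
  induction t with
  | zero =>
    intro J h
    obtain ⟨n, hn, hn1⟩ := (h.and (Filter.eventually_ge_atTop 1)).exists
    have hn' : samuel J n = 0 := hn
    have h1 : Module.length R (R ⧸ (J ⊔ maximalIdeal R ^ n)) = 0 := by
      rw [← coe_colength (isFiniteLength_sup_pow J n)]
      rw [samuel, colength] at hn'
      exact_mod_cast hn'
    have h2 : J ⊔ maximalIdeal R ^ n = ⊤ :=
      Ideal.Quotient.subsingleton_iff.1 (Module.length_eq_zero_iff.1 h1)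
    have h3 : J = ⊤ := by
      by_contra hne
      refine (maximalIdeal.isMaximal R).ne_top (top_le_iff.1 (h2 ▸ ?_))
      exact sup_le (le_maximalIdeal hne) (Ideal.pow_le_self (by omega))
    have : Subsingleton (R ⧸ J) := Ideal.Quotient.subsingleton_iff.2 h3
    rw [ringKrullDim_eq_bot_of_subsingleton]
    exact WithBot.bot_lt_coe _
  | succ t ih =>
    intro J h
    by_contra hcon
    obtain ⟨p, q, hJp, hpq, hq⟩ := exists_prime_lt_of_succ_le (not_lt.1 hcon)
    obtain ⟨x, hxq, hxp⟩ := Set.exists_of_ssubset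
      (show (p.asIdeal : Set R) ⊂ (q.asIdeal : Set R) from hpq)
    obtain ⟨D, hD⟩ := exists_hasLead_samuel p.asIdeal
    have hp : HasLead (t + 1) (samuel p.asIdeal) 0 := hD.zero_of_le
      (Filter.Eventually.of_forall fun n => samuel_nonneg _ n)
      (Filter.Eventually.of_forall fun n => samuel_anti hJp n) h
    obtain ⟨k, hk⟩ := exists_comap_sup_pow_le p.asIdeal x
    have hpx : Submodule.comap (smulMap R x) p.asIdeal = p.asIdeal := by
      ext y
      change x * y ∈ p.asIdeal ↔ y ∈ p.asIdeal
      exact ⟨fun h => (p.2.mem_or_mem h).resolve_left hxp, fun h => Ideal.mul_mem_left _ _ h⟩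
    obtain ⟨D', hD'⟩ := exists_hasLead_samuel (p.asIdeal ⊔ Ideal.span {x})
    have hpk := (hasLead_succ_iff.1 hp).sub_comp_add k
    rw [mul_zero] at hpk
    have hlead : HasLead t (samuel (p.asIdeal ⊔ Ideal.span {x})) 0 := by
      refine HasLead.of_comp_add k ((hD'.comp_add k).zero_of_le
        (Filter.Eventually.of_forall fun n => samuel_nonneg _ _)
        (Filter.Eventually.of_forall fun n => ?_) hpk)
      rw [samuel_sup_span]
      refine sub_le_sub_left (colength_anti ?_ ?_) _
      · have := isFiniteLength_quotient_inf_comap isFiniteLength_top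
          (isFiniteLength_sup_pow p.asIdeal (n + k)) (smulMap R x)
        rwa [top_inf_eq] at this
      · have := hk n
        rwa [hpx] at this
    refine absurd (ih hlead) (not_lt.2 (hq.trans ?_))
    exact ringKrullDim_le_of_surjective (Ideal.Quotient.factor
      (sup_le hpq.le ((Ideal.span_singleton_le_iff_mem _).2 hxq)))
      (Ideal.Quotient.factor_surjective _)

end HilbertIdeal

/-! ### Perturbing one element -/

section Perturbation
variable {R : Type u} [CommRing R] [IsLocalRing R] [IsNoetherianRing R]

omit [IsNoetherianRing R] in
/-- Modulo `m ^ (n + a)` with `a ≤ N`, perturbing `f` in `m ^ N` does not change `f m ^ n`. -/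
theorem mixedPow_congr {J : Ideal R} {f f' : R} {N : ℕ} (h : f' - f ∈ maximalIdeal R ^ N) {a : ℕ}
    (ha : a ≤ N) (n : ℕ) : mixedPow J f a n = mixedPow J f' a n := by
  have key : ∀ {x y : R}, x - y ∈ maximalIdeal R ^ N →
      Ideal.span {x} * maximalIdeal R ^ n ≤
        Ideal.span {y} * maximalIdeal R ^ n ⊔ maximalIdeal R ^ (n + a) := by
    intro x y hxy z hz
    obtain ⟨w, hw, rfl⟩ := Ideal.mem_span_singleton_mul.1 hz
    rw [show x * w = y * w + (x - y) * w by ring]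
    refine Submodule.add_mem_sup (Ideal.mem_span_singleton_mul.2 ⟨w, hw, rfl⟩) ?_
    rw [add_comm, pow_add]
    exact Ideal.mul_mem_mul (Ideal.pow_le_pow_right ha hxy) hw
  have h' : f - f' ∈ maximalIdeal R ^ N := by
    rw [← neg_sub]
    exact neg_mem h
  refine le_antisymm ?_ ?_
  · rw [mixedPow, mixedPow, sup_assoc, sup_assoc]
    exact sup_le_sup le_rfl (sup_le (key h') le_sup_right)
  · rw [mixedPow, mixedPow, sup_assoc, sup_assoc]
    exact sup_le_sup le_rfl (sup_le (key h) le_sup_right)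

/-- The length of `(J + f m ^ n + m ^ (n + j)) / (J + f m ^ n + m ^ (n + j + 1))`. -/
def layer (J : Ideal R) (f : R) (j n : ℕ) : ℤ :=
  colength (mixedPow J f (j + 1) n) - colength (mixedPow J f j n)

omit [IsNoetherianRing R] in
theorem mixedPow_anti (J : Ideal R) (f : R) {j k : ℕ} (h : j ≤ k) (n : ℕ) :
    mixedPow J f k n ≤ mixedPow J f j n :=
  sup_le_sup le_rfl (Ideal.pow_le_pow_right (by omega))

theorem layer_nonneg (J : Ideal R) (f : R) (j n : ℕ) : 0 ≤ layer J f j n :=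
  sub_nonneg.2 (colength_anti (isFiniteLength_mixedPow _ _ _ _) (mixedPow_anti _ _ (by omega) _))

omit [IsNoetherianRing R] in
theorem sum_layer (J : Ideal R) (f : R) (a n : ℕ) :
    ∑ j ∈ Finset.range a, layer J f j n = colength (mixedPow J f a n) - samuel J n := by
  have := Finset.sum_range_sub (fun j => colength (mixedPow J f j n)) a
  rw [mixedPow_zero_right] at this
  exact this

theorem layer_le (J : Ideal R) (f : R) {a j : ℕ} (h : j < a) (n : ℕ) :
    layer J f j n ≤ samuel (J ⊔ Ideal.span {f}) (n + a) := by
  refine le_trans ?_ (colength_mixedPow_sub_le J f a n)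
  rw [← sum_layer]
  exact Finset.single_le_sum (f := fun j => layer J f j n) (fun i _ => layer_nonneg _ _ _ _)
    (Finset.mem_range.2 h)

theorem layer_add_le (J : Ideal R) (f : R) (j k n : ℕ) :
    layer J f (j + k) n ≤ layer J f j (n + k) := by
  have key : ∀ i, mixedPow J f (i + k) n =
      mixedPow J f i (n + k) ⊔ Ideal.span {f} * maximalIdeal R ^ n := by
    intro i
    have h : Ideal.span {f} * maximalIdeal R ^ (n + k) ≤ Ideal.span {f} * maximalIdeal R ^ n :=
      Ideal.mul_mono_right (Ideal.pow_le_pow_right (by omega))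
    rw [mixedPow, mixedPow, sup_right_comm (J ⊔ Ideal.span {f} * maximalIdeal R ^ (n + k)),
      sup_assoc J (Ideal.span {f} * maximalIdeal R ^ (n + k)), sup_eq_right.2 h,
      show n + (i + k) = n + k + i by ring]
  rw [layer, layer, show j + k + 1 = j + 1 + k by ring, key, key]
  exact colength_sup_sub_le (mixedPow_anti _ _ (by omega) _) (isFiniteLength_mixedPow _ _ _ _) _

/-- Let `c`, the leading coefficient in degree `s` of the Hilbert-Samuel function of `R/(J + f)`,
be less than `N`. The layers of `f` with `j < N` have nonnegative leading coefficients with sum at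
most `c`, so that one of them, for `j₀` say, is zero. These layers do not change when `f` is
perturbed by an element of `m ^ N`, and for the perturbed element all layers with `j ≥ j₀` are
bounded by shifts of the `j₀`-th one. So the sums of the layers of `f'` still have leading
coefficients at most `c`. -/
theorem exists_hasLead_mixedPow_sub {J : Ideal R} {f f' : R} (hf : f ∈ maximalIdeal R)
    (hf' : f' ∈ maximalIdeal R) {N : ℕ} (hN : f' - f ∈ maximalIdeal R ^ N) {s : ℕ} {c : ℤ}
    (hc : HasLead s (samuel (J ⊔ Ideal.span {f})) c) (hcN : c < N) (a : ℕ) :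
    ∃ c', HasLead s (fun n => colength (mixedPow J f' a n) - samuel J n) c' ∧ c' ≤ c := by
  have h1 : ∀ j < N, ∃ b, HasLead s (layer J f j) b ∧ 0 ≤ b := by
    intro j hj
    obtain ⟨D, hD⟩ := exists_hasLead_mixedPow J hf j
    obtain ⟨b, hb, h0, -⟩ := exists_hasLead_of_le (h := layer J f j) hD
      (Filter.Eventually.of_forall fun n => layer_nonneg _ _ _ _)
      (Filter.Eventually.of_forall fun n => layer_le J f hj n) (hc.comp_add N)
    exact ⟨b, hb, h0⟩
  choose! b hb hb0 using h1
  -- the first `N` layers together stay below the Samuel function of `R / (J + f)`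
  have hsum : ∑ j ∈ Finset.range N, b j ≤ c := by
    refine (HasLead.sum (Finset.range N) (h := layer J f)
      (fun j hj => hb j (Finset.mem_range.1 hj))).le (hc.comp_add N)
      (Filter.Eventually.of_forall fun n => ?_)
    rw [sum_layer]
    exact colength_mixedPow_sub_le J f N n
  obtain ⟨j₀, hj₀, hbj₀⟩ : ∃ j < N, b j = 0 := by
    by_contra! hne
    have : ∑ j ∈ Finset.range N, (1 : ℤ) ≤ ∑ j ∈ Finset.range N, b j := by
      refine Finset.sum_le_sum fun j hj => ?_
      have h1 := hne j (Finset.mem_range.1 hj)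
      have h2 := hb0 j (Finset.mem_range.1 hj)
      omega
    simp at this
    omega
  have hlayer : ∀ j < N, layer J f' j = layer J f j := by
    intro j hj
    ext n
    rw [layer, layer, mixedPow_congr hN (by omega), mixedPow_congr hN (by omega)]
  have hb' : ∀ j, HasLead s (layer J f' j) (if j < N then b j else 0) := by
    intro j
    split_ifs with hj
    · rw [hlayer j hj]
      exact hb j hj
    · obtain ⟨D, hD⟩ := exists_hasLead_mixedPow J hf' j
      have h0 : HasLead s (layer J f' j₀) 0 := by
        rw [hlayer _ hj₀, ← hbj₀]
        exact hb _ hj₀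
      refine HasLead.zero_of_le (h := layer J f' j) hD
        (Filter.Eventually.of_forall fun n => layer_nonneg _ _ _ _)
        (Filter.Eventually.of_forall fun n => ?_) (h0.comp_add (j - j₀))
      have := layer_add_le J f' j₀ (j - j₀) n
      rwa [Nat.add_sub_cancel' (by omega)] at this
  have h2 := HasLead.sum (Finset.range a) (h := layer J f') (fun j _ => hb' j)
  simp only [sum_layer] at h2
  refine ⟨_, h2, le_trans ?_ hsum⟩
  rw [← Finset.sum_filter]
  refine Finset.sum_le_sum_of_subset_of_nonneg ?_ fun j hj _ => hb0 j (Finset.mem_range.1 hj)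
  intro j hj
  exact Finset.mem_range.2 (Finset.mem_filter.1 hj).2

/-- A perturbation of `f` in `m ^ N` does not raise `dim R/(J + f)`. With `Q = J + f'`, the length
of `m ^ n (R/Q) / m ^ (n + a) (R/Q)` is bounded by the sum of the first `a` layers of `f'`, whose
leading coefficient does not exceed `c` however large `a` is; so the
Hilbert-Samuel function of `R/Q` has degree at most `s`. -/
theorem ringKrullDim_lt_of_sub_mem {J : Ideal R} {f f' : R} (hf : f ∈ maximalIdeal R)
    (hf' : f' ∈ maximalIdeal R) {N : ℕ} (hN : f' - f ∈ maximalIdeal R ^ N) {s : ℕ} {c : ℤ}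
    (hc : HasLead s (samuel (J ⊔ Ideal.span {f})) c) (hcN : c < N) :
    ringKrullDim (R ⧸ (J ⊔ Ideal.span {f'})) < (s + 1 : ℕ) := by
  set Q := J ⊔ Ideal.span {f'} with hQ
  have hle : ∀ a n, samuel Q (n + a) - samuel Q n ≤
      colength (mixedPow J f' a n) - samuel J n := by
    intro a n
    have h := colength_sup_sub_le (X := J ⊔ maximalIdeal R ^ n) (Y := mixedPow J f' a n)
      (by rw [← mixedPow_zero_right J f']; exact mixedPow_anti _ _ (by omega) _)
      (isFiniteLength_mixedPow _ _ _ _) (Ideal.span {f'})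
    have h1 : mixedPow J f' a n ⊔ Ideal.span {f'} = Q ⊔ maximalIdeal R ^ (n + a) := by
      have h2 : Ideal.span {f'} * maximalIdeal R ^ n ≤ Ideal.span {f'} := Ideal.mul_le_left
      rw [mixedPow, sup_right_comm, sup_assoc J, sup_eq_right.2 h2]
    rw [sup_right_comm J, h1] at h
    exact h
  obtain ⟨D, hD⟩ := exists_hasLead_samuel Q
  obtain ⟨c₁, hc₁, hc₁c⟩ := exists_hasLead_mixedPow_sub hf hf' hN hc hcN 1
  obtain ⟨b, hb, hb0, -⟩ := exists_hasLead_of_le (h := fun n => samuel Q (n + 1) - samuel Q n)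
    (hasLead_succ_iff.1 hD.succ)
    (Filter.Eventually.of_forall fun n => sub_nonneg.2 (samuel_mono _ (by omega)))
    (Filter.Eventually.of_forall (hle 1)) hc₁
  have hc0 : 0 ≤ c := hc.nonneg (Filter.Eventually.of_forall fun n => samuel_nonneg _ _)
  obtain ⟨k, rfl⟩ := Int.eq_ofNat_of_zero_le hc0
  obtain ⟨c₂, hc₂, hc₂c⟩ := exists_hasLead_mixedPow_sub hf hf' hN hc hcN (k + 1)
  have h3 := (hb.sub_comp_add (k + 1)).le hc₂ (Filter.Eventually.of_forall (hle (k + 1)))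
  -- otherwise `c + 1` steps of `Q` would grow faster than the bound `c` allows
  have hb00 : b = 0 := by
    by_contra hne
    have : 1 ≤ b := by omega
    push_cast at h3
    nlinarith
  rw [hb00] at hb
  exact ringKrullDim_lt_of_hasLead (hasLead_succ_iff.2 hb)

/-- When `f` has kernel of finite length `l` on `R/J`, the inequality of `colength_mixedPow_sub_le`
is an equality up to `l`, for a suitable `a`. -/
theorem exists_samuel_le_mixedPow {J : Ideal R} {f : R}
    (hker : IsFiniteLength R (LinearMap.ker (smulMap (R ⧸ J) f))) :
    ∃ a l : ℕ, ∀ n, samuel (J ⊔ Ideal.span {f}) (n + a) ≤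
      colength (mixedPow J f a n) - samuel J n + l := by
  obtain ⟨a, ha⟩ := exists_comap_sup_pow_le J f
  obtain ⟨l, hl⟩ := ENat.ne_top_iff_exists.1 (Module.length_ne_top_iff.2 hker)
  refine ⟨a, l, fun n => ?_⟩
  have hB := isFiniteLength_quotient_inf_comap isFiniteLength_top
          (isFiniteLength_sup_pow J (n + a)) (smulMap R f)
  rw [top_inf_eq] at hB
  have h1 := colength_inf_add_sup (isFiniteLength_sup_pow J n) hB
  have h2 := colength_anti (isFiniteLength_quotient_mono le_sup_left (isFiniteLength_sup_pow J n))
    (sup_le le_sup_left ((ha n).trans (sup_le le_sup_right (le_sup_right.trans le_sup_left))) :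
      J ⊔ maximalIdeal R ^ n ⊔ Submodule.comap (smulMap R f) (J ⊔ maximalIdeal R ^ (n + a)) ≤
        J ⊔ maximalIdeal R ^ n ⊔ Submodule.comap (smulMap R f) J)
  have h3 := colength_le_colength_sup_add (J := J) (A := J ⊔ maximalIdeal R ^ n)
    (C := Submodule.comap (smulMap R f) J) le_sup_left (isFiniteLength_sup_pow J n) (l := l) (by
      rw [hl]
      refine Module.length_le_of_injective _ (Submodule.inclusion_injective ?_)
      rintro _ ⟨y, hy, rfl⟩
      exact (Submodule.Quotient.mk_eq_zero _).2 hy)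
  rw [samuel_sup_span, colength_mixedPow_sub]
  linarith

/-- A perturbation of `f` in `m ^ N` does not raise the multiplicity of `R/(J + f)`, provided the
kernel of the perturbed element on `R/J` has finite length. -/
theorem exists_hasLead_samuel_of_sub_mem {J : Ideal R} {f f' : R} (hf : f ∈ maximalIdeal R)
    (hf' : f' ∈ maximalIdeal R) {N : ℕ} (hN : f' - f ∈ maximalIdeal R ^ N) {s : ℕ} {c : ℤ}
    (hs : 0 < s) (hc : HasLead s (samuel (J ⊔ Ideal.span {f})) c) (hcN : c < N)
    (hker : IsFiniteLength R (LinearMap.ker (smulMap (R ⧸ J) f'))) :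
    ∃ c', HasLead s (samuel (J ⊔ Ideal.span {f'})) c' ∧ c' ≤ c := by
  obtain ⟨a, l, hal⟩ := exists_samuel_le_mixedPow hker
  obtain ⟨c₁, hc₁, hc₁c⟩ := exists_hasLead_mixedPow_sub hf hf' hN hc hcN a
  -- as `s > 0`, the constant `l` does not contribute to the leading coefficient
  obtain ⟨s, rfl⟩ : ∃ t, s = t + 1 := ⟨s - 1, by omega⟩
  obtain ⟨D, hD⟩ := exists_hasLead_samuel (J ⊔ Ideal.span {f'})
  have h := hc₁.add (hasLead_const s l)
  rw [add_zero] at h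
  obtain ⟨c', hc', -, h'⟩ := exists_hasLead_of_le (hD.comp_add a)
    (Filter.Eventually.of_forall fun n => samuel_nonneg _ _) (Filter.Eventually.of_forall hal) h
  exact ⟨c', hc'.of_comp_add a, h'.trans hc₁c⟩

end Perturbation

/-! ### Multiplicities and binomial coefficients -/

section Binomial
open Filter

theorem HasLead.const_mul {s : ℕ} {h : ℕ → ℤ} {c : ℤ} (b : ℤ) (hh : HasLead s h c) :
    HasLead s (fun n => b * h n) (b * c) := by
  filter_upwards [hh] with n h1
  have := fwdDiff_iter_const_smul (1 : ℕ) b h s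
  have h2 : (fun n => b * h n) = b • h := by ext; simp
  rw [h2, this, Pi.smul_apply, h1, smul_eq_mul]

theorem hasLead_choose (s : ℕ) : HasLead s (fun n => ((n + s).choose s : ℤ)) 1 := by
  induction s with
  | zero => exact Eventually.of_forall fun n => by simp
  | succ s ih =>
    refine hasLead_succ_iff.2 ((ih.comp_add 1).congr (Eventually.of_forall fun n => ?_))
    have := Nat.choose_succ_succ (n + 1 + s) s
    rw [show n + 1 + (s + 1) = (n + 1 + s).succ by omega, this,
      show n + (s + 1) = n + 1 + s by omega]
    push_cast
    ring

/-- An integer sequence that is eventually polynomial of degree at most `s` is eventually an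
integral combination of binomial coefficients. -/
theorem HasLead.exists_sum_choose {s : ℕ} {h : ℕ → ℤ} {c : ℤ} (hh : HasLead s h c) :
    ∃ b : ℕ → ℤ, b 0 = c ∧ ∀ᶠ n in atTop,
      h n = ∑ i ∈ Finset.range (s + 1), (-1) ^ i * b i * ((n + s - i).choose (s - i) : ℤ) := by
  induction s generalizing h c with
  | zero =>
    refine ⟨fun _ => c, rfl, Eventually.mono hh fun n hn => ?_⟩
    simpa using hn
  | succ s ih =>
    have h1 := hh.sub ((hasLead_choose (s + 1)).const_mul c)
    rw [mul_one, sub_self] at h1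
    obtain ⟨c', hc'⟩ := hasLead_succ_iff_exists.1 h1
    obtain ⟨b, -, hb⟩ := ih hc'
    refine ⟨fun i => i.casesOn c fun j => - b j, rfl, hb.mono fun n hn => ?_⟩
    rw [Finset.sum_range_succ']
    rw [sub_eq_iff_eq_add] at hn
    rw [hn]
    congr 1
    · refine Finset.sum_congr rfl fun i _ => ?_
      rw [show n + (s + 1) - (i + 1) = n + s - i by omega, show s + 1 - (i + 1) = s - i by omega]
      ring
    · simp

theorem hasLead_of_eventually_eq_sum_choose {s : ℕ} {h : ℕ → ℤ} (b : ℕ → ℤ)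
    (hb : ∀ᶠ n in atTop,
      h n = ∑ i ∈ Finset.range (s + 1), (-1) ^ i * b i * ((n + s - i).choose (s - i) : ℤ)) :
    HasLead s h (b 0) := by
  have h1 : ∀ i ∈ Finset.range (s + 1),
      HasLead s (fun n => (-1) ^ i * b i * ((n + s - i).choose (s - i) : ℤ))
        ((-1) ^ i * b i * if i = 0 then 1 else 0) := by
    intro i hi
    rw [Finset.mem_range] at hi
    refine HasLead.const_mul _ ?_
    have h2 : HasLead (s - i) (fun n => ((n + s - i).choose (s - i) : ℤ)) 1 :=
      (hasLead_choose (s - i)).congr (Eventually.of_forall fun n => by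
        rw [Nat.add_sub_assoc (by omega)])
    split_ifs with h0
    · subst h0
      exact h2
    · exact h2.of_lt (by omega)
  have h2 := HasLead.sum _ h1
  rw [Finset.sum_eq_single 0 (fun i _ h => by simp [h]) (by simp)] at h2
  simp only [pow_zero, one_mul, if_true, mul_one] at h2
  exact h2.congr (hb.mono fun n hn => hn.symm)

end Binomial

/-! ### Perturbing a part of a system of parameters -/

section System
variable {R : Type u} [CommRing R] [IsLocalRing R] [IsNoetherianRing R]

omit [IsNoetherianRing R] in
theorem hilbertFunction_quotient (I : Ideal R) (n : ℕ) : hilbertFunction R (R ⧸ I) n =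
    Module.length R (R ⧸ (I ⊔ maximalIdeal R ^ (n + 1))) := by
  have h : maximalIdeal R ^ (n + 1) • (⊤ : Submodule R (R ⧸ I)) =
      Submodule.map I.mkQ (maximalIdeal R ^ (n + 1)) := by
    rw [← Submodule.range_mkQ I, ← Submodule.map_top, ← Submodule.map_smul'', Ideal.smul_eq_mul,
      Ideal.mul_top]
  rw [hilbertFunction, h, (Submodule.quotientQuotientEquivQuotientSup I _).length_eq]

/-- The multiplicity is the leading coefficient of the Hilbert-Samuel function. In particular
`multiplicity` does not take its default value here. -/
theorem hasLead_samuel_multiplicity {I : Ideal R} {s : ℕ} (hdim : ringKrullDim (R ⧸ I) = s)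
    (h : HasLead (s + 1) (samuel I) 0) : HasLead s (samuel I) (multiplicity R (R ⧸ I)) := by
  have hfin : ∀ n, hilbertFunction R (R ⧸ I) n =
      ((Module.length R (R ⧸ (I ⊔ maximalIdeal R ^ (n + 1)))).toNat : ℕ) := fun n => by
    rw [hilbertFunction_quotient, coe_colength (isFiniteLength_sup_pow I (n + 1))]
  have hsd : Module.supportDim R (R ⧸ I) = s := by
    rw [Module.supportDim_quotient_eq_ringKrullDim, hdim]
  have hex : ∃ e, IsMultiplicity R (R ⧸ I) e := by
    obtain ⟨c, hc⟩ := hasLead_succ_iff_exists.1 h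
    obtain ⟨e, rfl⟩ := Int.eq_ofNat_of_zero_le
      (hc.nonneg (Filter.Eventually.of_forall fun n => samuel_nonneg _ _))
    obtain ⟨b, hb0, hb⟩ := (hc.comp_add 1).exists_sum_choose
    exact ⟨e, s, b, hsd, hb0, hb.mono fun n hn => ⟨_, hfin n, hn⟩⟩
  rw [multiplicity, dif_pos hex]
  obtain ⟨s', b, hs', hb0, hb⟩ := hex.choose_spec
  have : s' = s := by
    rw [hsd] at hs'
    exact_mod_cast hs'.symm
  subst this
  rw [← hb0]
  refine HasLead.of_comp_add 1 (hasLead_of_eventually_eq_sum_choose b (hb.mono fun n hn => ?_))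
  obtain ⟨k, hk, hk'⟩ := hn
  rw [hfin, Nat.cast_inj] at hk
  rw [← hk', ← hk]
  rfl

theorem ringKrullDim_span_image_le {r : ℕ} (f : Fin r → R) (hf : ∀ j, f j ∈ maximalIdeal R)
    (T U : Finset (Fin r)) : ringKrullDim (R ⧸ Ideal.span (f '' T)) ≤
      ringKrullDim (R ⧸ Ideal.span (f '' (T ∪ U : Finset (Fin r)))) + U.card := by
  induction U using Finset.induction_on with
  | empty => rw [Finset.union_empty, Finset.card_empty, Nat.cast_zero, add_zero]
  | insert k U hk ih =>
    refine ih.trans ?_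
    have h := ringKrullDim_quotient_le_add_one
      (J := Ideal.span (f '' (T ∪ U : Finset (Fin r)))) (hf k)
    have h2 : Ideal.span (f '' (T ∪ insert k U : Finset (Fin r))) =
        Ideal.span (f '' (T ∪ U : Finset (Fin r))) ⊔ Ideal.span {f k} := by
      rw [Finset.union_insert, Finset.coe_insert, Set.image_insert_eq, Ideal.span_insert, sup_comm]
    rw [h2, Finset.card_insert_of_notMem hk]
    refine (add_le_add_left h _).trans_eq ?_
    push_cast
    rw [add_assoc, add_comm (1 : WithBot ℕ∞)]

theorem withBot_le_of_lt_succ {a : WithBot ℕ∞} {s : ℕ} (h : a < ((s + 1 : ℕ) : WithBot ℕ∞)) :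
    a ≤ (s : ℕ) := by
  induction a with
  | bot => exact bot_le
  | coe a =>
    have h' : a < ((s + 1 : ℕ) : ℕ∞) := WithBot.coe_lt_coe.1 h
    exact WithBot.coe_le_coe.2 (Order.le_of_lt_succ (by simpa [Order.succ_eq_add_one] using h'))

theorem ringKrullDim_span_image_add_card_le {r s : ℕ} (f : Fin r → R)
    (hf : ∀ j, f j ∈ maximalIdeal R)
    (hdim : ringKrullDim (R ⧸ Ideal.span (Set.range f)) < (s + 1 : ℕ)) (T : Finset (Fin r)) :
    ringKrullDim (R ⧸ Ideal.span (f '' T)) + T.card ≤ (r + s : ℕ) := by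
  have h := ringKrullDim_span_image_le f hf T Tᶜ
  rw [Finset.union_compl, Finset.coe_univ, Set.image_univ] at h
  have h2 : ringKrullDim (R ⧸ Ideal.span (Set.range f)) ≤ (s : ℕ) := by
    exact withBot_le_of_lt_succ hdim
  have h3 : T.card + Tᶜ.card = r := by
    rw [Finset.card_add_card_compl, Fintype.card_fin]
  calc ringKrullDim (R ⧸ Ideal.span (f '' T)) + T.card
      ≤ ((s : ℕ) + Tᶜ.card : WithBot ℕ∞) + T.card := by gcongr; exact h.trans (by gcongr)
    _ = ((T.card + Tᶜ.card + s : ℕ) : WithBot ℕ∞) := by push_cast; ring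
    _ = (r + s : ℕ) := by rw [h3]

/-- The inductive step: replace the single element `f k`. With `J` generated by the other elements,
`R/J` has finite local cohomology below degree `s + 1`, of length at most the Buchsbaum invariant
of `R`, while `R/(J + f k)` and `R/(J + y)` both have dimension at most `s`. -/
theorem lcLength_update_eq {r s N : ℕ} (f : Fin r → R) (hf : ∀ j, f j ∈ maximalIdeal R) (k : Fin r)
    {y : R} (hy : y ∈ maximalIdeal R) (hyN : y - f k ∈ maximalIdeal R ^ N) (hs : 0 < s)
    (hR : ∀ i < r + s, lcLength (⊥ : Ideal R) i ≠ ⊤)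
    (hRN : binomialSum (lcLength (⊥ : Ideal R)) (r + s - 1) 0 ≤ N) {c : ℤ}
    (hc : HasLead s (samuel (Ideal.span (Set.range f))) c) (hcN : c < N) :
    (∃ c', HasLead s (samuel (Ideal.span (Set.range (Function.update f k y)))) c' ∧ c' ≤ c) ∧
      ∀ i < s, lcLength (Ideal.span (Set.range f)) i =
        lcLength (Ideal.span (Set.range (Function.update f k y))) i := by
  set J := Ideal.span (f '' (Finset.univ.erase k : Finset (Fin r))) with hJ
  have hrange : ∀ z, Ideal.span (Set.range (Function.update f k z)) = J ⊔ Ideal.span {z} := by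
    intro z
    have : Set.range (Function.update f k z) =
        insert z (f '' (Finset.univ.erase k : Finset (Fin r))) := by
      ext w
      simp only [Set.mem_range, Set.mem_insert_iff, Set.mem_image, Finset.mem_coe,
        Finset.mem_erase, Finset.mem_univ, and_true]
      constructor
      · rintro ⟨j, rfl⟩
        by_cases hj : j = k
        · subst hj; simp
        · exact Or.inr ⟨j, hj, by simp [hj]⟩
      · rintro (rfl | ⟨j, hj, rfl⟩)
        · exact ⟨k, by simp⟩
        · exact ⟨j, by simp [hj]⟩
    rw [this, Ideal.span_insert, sup_comm]
  have hf0 : Ideal.span (Set.range f) = J ⊔ Ideal.span {f k} := by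
    rw [← hrange, Function.update_eq_self]
  have hcard : (Finset.univ.erase k : Finset (Fin r)).card = r - 1 := by simp
  have hr : 0 < r := k.pos
  have hdim : ringKrullDim (R ⧸ Ideal.span (Set.range f)) < (s + 1 : ℕ) :=
    ringKrullDim_lt_of_hasLead hc.succ
  have hlen := lcLength_span_le f (r + s) Finset.univ hR
    (fun T _ => ringKrullDim_span_image_add_card_le f hf hdim T) (Finset.univ.erase k)
    (Finset.subset_univ _)
  rw [hcard, ← hJ] at hlen
  have hfin : ∀ i < s + 1, IsFiniteLength R (LC R i (R ⧸ J)) := fun i hi =>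
    Module.length_ne_top_iff.1 (hlen i (by omega)).1
  have hle : ∀ i < s + 1, lcLength J i ≤ N := fun i hi =>
    (hlen i (by omega)).2.trans ((binomialSum_le _ (by omega)).trans hRN)
  rw [hf0] at hc hdim
  have hdim' := ringKrullDim_lt_of_sub_mem (hf k) hy hyN hc hcN
  have hker := isFiniteLength_ker_of_ringKrullDim_lt hfin hdim
  have hker' := isFiniteLength_ker_of_ringKrullDim_lt hfin hdim'
  rw [hrange, hf0]
  refine ⟨exists_hasLead_samuel_of_sub_mem (hf k) hy hyN hs hc hcN hker', fun i hi => ?_⟩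
  refine lcLength_sup_span_eq (N := N) ?_ hker hker' i (hle i (by omega)) (hle (i + 1) (by omega))
  rw [← neg_sub]
  exact neg_mem hyN

/-- Perturb the elements one at a time; the leading coefficient `c` of the Hilbert-Samuel function
does not increase along the way. -/
theorem lcLength_add_eq {r s N : ℕ} (f ε : Fin r → R) (hf : ∀ j, f j ∈ maximalIdeal R)
    (hε : ∀ j, ε j ∈ maximalIdeal R ^ N) (hs : 0 < s)
    (hR : ∀ i < r + s, lcLength (⊥ : Ideal R) i ≠ ⊤)
    (hRN : binomialSum (lcLength (⊥ : Ideal R)) (r + s - 1) 0 ≤ N) {c : ℤ}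
    (hc : HasLead s (samuel (Ideal.span (Set.range f))) c) (hcN : c < N) {i : ℕ} (hi : i < s) :
    lcLength (Ideal.span (Set.range f)) i =
      lcLength (Ideal.span (Set.range fun j => f j + ε j)) i := by
  classical
  have hN : N ≠ 0 := by
    rintro rfl
    have := hc.nonneg (Filter.Eventually.of_forall fun n => samuel_nonneg _ _)
    simp at hcN
    omega
  have hεm : ∀ j, f j + ε j ∈ maximalIdeal R := fun j =>
    add_mem (hf j) (Ideal.pow_le_self hN (hε j))
  have key : ∀ S : Finset (Fin r),
      (∃ c', HasLead s (samuel (Ideal.span (Set.range (S.piecewise (fun j => f j + ε j) f)))) c' ∧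
        c' ≤ c) ∧ lcLength (Ideal.span (Set.range f)) i =
        lcLength (Ideal.span (Set.range (S.piecewise (fun j => f j + ε j) f))) i := by
    intro S
    induction S using Finset.induction_on with
    | empty => simpa using ⟨c, hc, le_rfl⟩
    | insert k S hk ih =>
      obtain ⟨⟨c', hc', hcc⟩, hl⟩ := ih
      rw [Finset.piecewise_insert]
      obtain ⟨⟨c'', h1, h2⟩, h3⟩ := lcLength_update_eq (S.piecewise (fun j => f j + ε j) f)
        (fun j => by by_cases hj : j ∈ S <;> simp [hj, hf, hεm]) k (hεm k)
        (by simpa [hk] using hε k) hs hR hRN hc' (hcc.trans_lt hcN)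
      exact ⟨⟨c'', h1, h2.trans hcc⟩, hl.trans (h3 i hi)⟩
  simpa using (key Finset.univ).2

omit [IsNoetherianRing R] in
theorem lcLength_bot (i : ℕ) : lcLength (⊥ : Ideal R) i = Module.length R (LC R i R) :=
  (lcEquiv (maximalIdeal R) i (Submodule.quotEquivOfEqBot (⊥ : Ideal R) rfl)).length_eq

end System

end GenCM

end

theorem mainTheorem2 {R : Type u} [CommRing R] [IsLocalRing R] [IsNoetherianRing R]
    (hR : GenCM.IsGeneralizedCohenMacaulay R R)
    (d : ℕ) (hd : ringKrullDim R = d)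
    (r : ℕ) (f : Fin r → R) (hf : GenCM.IsPartOfSystemOfParameters f)
    (I : Ideal R) (hI : I = Ideal.span (Set.range f))
    (N : ℕ) (hN : N = GenCM.multiplicity R (R ⧸ I) + GenCM.buchsbaumInvariant R R + 1)
    (I_N : Ideal R) (hI_N : I_N ∈ GenCM.perturbations f N)
    (i : ℕ) (hi : i + r < d) :
    Module.length R (GenCM.LC R i (R ⧸ I)) = Module.length R (GenCM.LC R i (R ⧸ I_N)) := by
  obtain ⟨s, g, hdim, hrad⟩ := hf
  obtain ⟨ε, hε, rfl⟩ := hI_N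
  obtain rfl : d = r + s := by
    rw [hd] at hdim
    exact_mod_cast hdim
  have happ : Set.range (Fin.append f g) = Set.range f ∪ Set.range g := by
    ext z
    constructor
    · rintro ⟨j, rfl⟩
      refine Fin.addCases (fun j => ?_) (fun j => ?_) j <;> simp
    · rintro (⟨j, rfl⟩ | ⟨j, rfl⟩)
      · exact ⟨Fin.castAdd s j, Fin.append_left f g j⟩
      · exact ⟨Fin.natAdd r j, Fin.append_right f g j⟩
  rw [happ, Ideal.span_union] at hrad
  have hle : Ideal.span (Set.range f) ⊔ Ideal.span (Set.range g) ≤ maximalIdeal R :=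
    hrad ▸ Ideal.le_radical
  have hfm : ∀ j, f j ∈ maximalIdeal R := fun j =>
    hle (Submodule.mem_sup_left (Ideal.subset_span ⟨j, rfl⟩))
  have hgm : ∀ j, g j ∈ maximalIdeal R := fun j =>
    hle (Submodule.mem_sup_right (Ideal.subset_span ⟨j, rfl⟩))
  obtain ⟨k, hk⟩ := Ideal.exists_pow_le_of_le_radical_of_fg hrad.ge (IsNoetherian.noetherian _)
  rw [← hI] at hk
  -- the `s` elements `g` generate an ideal primary to the maximal ideal modulo `I`
  have hlead := GenCM.hasLead_samuel_of_pow_le g hgm hk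
  -- killing an element lowers the dimension by at most one, so `r + s ≤ dim R/I + r`
  have hIs : ringKrullDim (R ⧸ I) = s := by
    have h1 := GenCM.ringKrullDim_span_image_le f hfm ∅ Finset.univ
    rw [Finset.empty_union, Finset.coe_univ, Set.image_univ, ← hI, Finset.coe_empty,
      Set.image_empty, Ideal.span_empty,
      ringKrullDim_eq_of_ringEquiv (RingEquiv.quotientBot R), hdim, Finset.card_fin] at h1
    have h2 := GenCM.withBot_le_of_lt_succ (GenCM.ringKrullDim_lt_of_hasLead hlead)
    refine le_antisymm h2 ?_
    generalize ringKrullDim (R ⧸ I) = a at h1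
    induction a with
    | bot => exact absurd h1 (by simp)
    | coe a =>
      have h3 : ((r + s : ℕ) : ℕ∞) ≤ a + (r : ℕ) := by exact_mod_cast h1
      rw [Nat.cast_add, add_comm] at h3
      exact WithBot.coe_le_coe.2 ((ENat.add_le_add_iff_right (ENat.natCast_ne_top r)).1 h3)
  have hc := GenCM.hasLead_samuel_multiplicity hIs hlead
  have hsd : Module.supportDim R R = (r + s : ℕ) := by
    rw [Module.supportDim_self_eq_ringKrullDim, hd]
  have hfin : ∀ i < r + s, GenCM.lcLength (⊥ : Ideal R) i ≠ ⊤ := by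
    intro i hi
    rw [GenCM.lcLength_bot]
    exact Module.length_ne_top_iff.2 (hR i (by rw [hsd]; exact_mod_cast hi))
  have hB : GenCM.binomialSum (GenCM.lcLength (⊥ : Ideal R)) (r + s - 1) 0 =
      GenCM.buchsbaumInvariant R R := by
    have hdimR : GenCM.dim R R = r + s := by
      rw [GenCM.dim, hsd]; rfl
    rw [GenCM.binomialSum_eq_sum, GenCM.buchsbaumInvariant, hdimR, Nat.cast_sum,
      Nat.sub_add_cancel (by omega)]
    refine Finset.sum_congr rfl fun j hj => ?_
    rw [zero_add, Nat.cast_mul, GenCM.lcLength_bot, ENat.natCast_toNat]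
    rw [← GenCM.lcLength_bot]
    exact hfin j (Finset.mem_range.1 hj)
  rw [hI] at hc
  have := GenCM.lcLength_add_eq f ε hfm hε (by omega) hfin
    (by rw [hB, hN]; norm_cast; omega) hc (by rw [hN, hI]; push_cast; omega) (i := i) (by omega)
  rw [hI]
  exact this
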